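/- Let $M$ be a closed topological 3-manifold with a triangulation $T$ (a finite simplicial complex; simplices are determined by their vertices), with vertex set $V$, edge set $E$ and directed edge set $E_+$. For $d:E_+\to\mathbb R$ put $\ell_{ij}=d_{ij}+d_{ji}$. Call $d$ a *metric* if every simplex of $T$ is realized by a nondegenerate Euclidean simplex with edge lengths $\ell$, and $d_{ij}^2+d_{jk}^2+d_{ki}^2=d_{ji}^2+d_{ik}^2+d_{kj}^2$ for each triangle $\{i,j,k\}$. Let $\gamma_{i,jk}$ be the angle at $i$ of the triangle $\{i,j,k\}$ and $\beta_{ij,kl}$ the dihedral angle at $\{i,j\}$ of the tetrahedron $\{i,j,k,l\}$. Define $$h_{ij,k}=\frac{d_{ik}-d_{ij}\cos\gamma_{i,jk}}{\sin\gamma_{i,jk}},\qquad h_{ijk,l}=\frac{h_{ij,l}-h_{ij,k}\cos\beta_{ij,kl}}{\sin\beta_{ij,kl}},$$ $$\ell^*_{ij}=\sum_{k,l}\tfrac12\left(h_{ij,k}h_{ijk,l}+h_{ij,l}h_{ijl,k}\right),\qquad K_{ij}=\Big(2\pi-\sum_{k,l}\beta_{ij,kl}\Big)\ell_{ij},$$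 $$K_i=\sum_{j}\Big(2\pi-\sum_{k,l}\beta_{ij,kl}\Big)d_{ij},\qquad \mathcal{EHR}(d)=\sum_{\{i,j\}\in E}K_{ij},$$ where the sums over $k,l$ are over the tetrahedra containing the edge $\{i,j\}$ (each counted once), and the sum over $j$ is over the edges at $i$. A *conformal structure* is a smooth map $f\mapsto d=\mathcal C[f]$ from an open set $U\subset\mathbb R^V$ to the metrics such that $\partial\ell_{ij}/\partial f_i=d_{ij}$ for each directed edge $(i,j)$, and $\partial d_{ij}/\partial f_k=0$ for $k\ne i,j$. Put $q_{ij}=\partial d_{ij}/\partial f_j$. The *sphere packing* conformal structure is $d_{ij}=e^{f_i}$, on the set $U$ of all $f$ for which this is a metric. Call a function $F$ on $U$ *convex on* a (not necessarily convex) set $S\subset U$ if $F$ is smooth near each $f\in S$, $\frac{d^2}{dt^2}\big|_{t=0}F(f+tv)\ge 0$ for all $f\in S$ and $v\in\mathbb R^V$, and $F$ is convex in the usual sense on each convex subset of $S$. **Theorem.** The function $f\mapsto\mathcal{EHR}(\mathcal C[f])$ is convex on each of the following sets: 1. for the sphere packing conformal structure $\mathcal C$ with domain $U$, the set of $f\in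 U$ with $K_i\ge 0$ for all $i\in V$; 2. for an arbitrary conformal structure $\mathcal C$ with domain $U$, the set of $f\in U$ with $\ell^*_{ij}-\tfrac12 q_{ij}K_{ij}>0$ for each $\{i,j\}\in E$ and $K_i\ge 0$ for all $i\in V$. -/

import Mathlib

open scoped ContDiff

namespace PiecewiseFlat

/-- The geometric realization of a finite abstract simplicial complex, in barycentric coordinates:
the points of the standard simplex whose support is a face. -/
def realization {V : Type*} [Fintype V] (K : AbstractSimplicialComplex V) : Set (V → ℝ) :=
  {x | x ∈ stdSimplex ℝ V ∧ ∃ s ∈ K.faces, ∀ i, i ∈ s ↔ x i ≠ 0}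

/-- A triangulation of the space `M` with (finite) vertex set `V`: a simplicial complex on `V`
together with a homeomorphism of its realization onto `M`. A simplex is determined by its set of
vertices. -/
structure Triangulation (M : Type*) [TopologicalSpace M] (V : Type*) [Fintype V] where
  complex : AbstractSimplicialComplex V
  homeo : realization complex ≃ₜ M

section Combinatorics

variable {V : Type*} [DecidableEq V]

/-- `(i, j)` is a directed edge, i.e. `{i, j}` is an edge. -/
def IsEdge (K : AbstractSimplicialComplex V) (i j : V) : Prop :=
  i ≠ j ∧ ({i, j} : Finset V) ∈ K.faces

/-- `{i, j, k}` is a triangle (the three vertices being distinct). -/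
def IsTriangle (K : AbstractSimplicialComplex V) (i j k : V) : Prop :=
  ({i, j, k} : Finset V).card = 3 ∧ ({i, j, k} : Finset V) ∈ K.faces

/-- `{i, j, k, l}` is a tetrahedron (the four vertices being distinct). -/
def IsTetrahedron (K : AbstractSimplicialComplex V) (i j k l : V) : Prop :=
  ({i, j, k, l} : Finset V).card = 4 ∧ ({i, j, k, l} : Finset V) ∈ K.faces

end Combinatorics

section Metrics

variable {V : Type*} [DecidableEq V]

/-- The edge lengths `ℓ_ij = d_ij + d_ji` of `d`.

A function `d` on the directed edges is written as `d : V → V → ℝ`; only its values on directed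
edges ever matter. -/
def len (d : V → V → ℝ) (i j : V) : ℝ := d i j + d j i

/-- Every simplex of `K` embeds as a nondegenerate Euclidean simplex with edge lengths `ℓ`
(simplices have dimension at most three). -/
def IsPiecewiseFlat (K : AbstractSimplicialComplex V) (ℓ : V → V → ℝ) : Prop :=
  ∀ s ∈ K.faces, ∃ p : s → EuclideanSpace ℝ (Fin 3), AffineIndependent ℝ p ∧
    ∀ i j : s, i ≠ j → dist (p i) (p j) = ℓ i j

/-- `d` is a piecewise flat metric: its edge lengths are those of a piecewise flat manifold, and
the compatibility condition holds in each triangle. -/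
def IsMetric (K : AbstractSimplicialComplex V) (d : V → V → ℝ) : Prop :=
  IsPiecewiseFlat K (len d) ∧
    ∀ i j k, IsTriangle K i j k →
      d i j ^ 2 + d j k ^ 2 + d k i ^ 2 = d j i ^ 2 + d i k ^ 2 + d k j ^ 2

end Metrics

section Geometry

variable {V : Type*}

/-- The angle `γ_{i,jk}` at vertex `i` in the triangle `{i, j, k}` (Euclidean cosine law). -/
noncomputable def angle (d : V → V → ℝ) (i j k : V) : ℝ :=
  Real.arccos ((len d i j ^ 2 + len d i k ^ 2 - len d j k ^ 2) / (2 * len d i j * len d i k))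

/-- The dihedral angle `β_{ij,kl}` at the edge `{i, j}` of the tetrahedron `{i, j, k, l}`
(spherical cosine law at the vertex `i`). -/
noncomputable def dihedral (d : V → V → ℝ) (i j k l : V) : ℝ :=
  Real.arccos ((Real.cos (angle d i k l) - Real.cos (angle d i j k) * Real.cos (angle d i j l)) /
    (Real.sin (angle d i j k) * Real.sin (angle d i j l)))

/-- The signed distance `h_{ij,k}` from the center of the edge `{i, j}` to the center of the
triangle `{i, j, k}`. -/
noncomputable def height₂ (d : V → V → ℝ) (i j k : V) : ℝ :=
  (d i k - d i j * Real.cos (angle d i j k)) / Real.sin (angle d i j k)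

/-- The signed distance `h_{ijk,l}` from the center of the triangle `{i, j, k}` to the center of the
tetrahedron `{i, j, k, l}`. -/
noncomputable def height₃ (d : V → V → ℝ) (i j k l : V) : ℝ :=
  (height₂ d i j l - height₂ d i j k * Real.cos (dihedral d i j k l)) /
    Real.sin (dihedral d i j k l)

/-- The signed area `A_{ij,kl}` of the part, dual to `{i, j}`, of the tetrahedron `{i, j, k, l}`. -/
noncomputable def dualArea (d : V → V → ℝ) (i j k l : V) : ℝ :=
  (1 / 2) * (height₂ d i j k * height₃ d i j k l + height₂ d i j l * height₃ d i j l k)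

end Geometry

section Curvature

variable {V : Type*} [Fintype V] [DecidableEq V]

open Classical in
/-- The angle deficit `2π - ∑ β_{ij,kl}` at the edge `{i, j}`. The sum is over the tetrahedra
containing the edge; each occurs for two ordered pairs `(k, l)`, hence the factor `1 / 2`. -/
noncomputable def deficit (K : AbstractSimplicialComplex V) (d : V → V → ℝ) (i j : V) : ℝ :=
  2 * Real.pi - (1 / 2) * ∑ k, ∑ l, if IsTetrahedron K i j k l then dihedral d i j k l else 0

open Classical in
/-- The dual length `ℓ*_ij = ∑ A_{ij,kl}`, the sum being over the tetrahedra containing the edge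
`{i, j}`, each of which occurs for two ordered pairs `(k, l)`. -/
noncomputable def dualLen (K : AbstractSimplicialComplex V) (d : V → V → ℝ) (i j : V) : ℝ :=
  (1 / 2) * ∑ k, ∑ l, if IsTetrahedron K i j k l then dualArea d i j k l else 0

/-- The edge curvature `K_ij`. -/
noncomputable def edgeCurvature (K : AbstractSimplicialComplex V) (d : V → V → ℝ) (i j : V) : ℝ :=
  deficit K d i j * len d i j

open Classical in
/-- The scalar curvature `K_i = ∑_j (2π - ∑ β_{ij,kl}) d_ij`, the sum being over the edges
at `i`. -/
noncomputable def scalarCurvature (K : AbstractSimplicialComplex V) (d : V → V → ℝ) (i : V) : ℝ :=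
  ∑ j, if IsEdge K i j then deficit K d i j * d i j else 0

open Classical in
/-- The Einstein–Hilbert–Regge functional: the sum of `K_ij` over the (undirected) edges, each of
which occurs for two directed edges. -/
noncomputable def EHR (K : AbstractSimplicialComplex V) (d : V → V → ℝ) : ℝ :=
  (1 / 2) * ∑ i, ∑ j, if IsEdge K i j then edgeCurvature K d i j else 0

/-- The partial derivative `∂F/∂f_k`. -/
noncomputable def partialDeriv (F : (V → ℝ) → ℝ) (k : V) (f : V → ℝ) : ℝ :=
  fderiv ℝ F f (Pi.single k 1)

/-- `C` is a conformal structure on the open set `U` of functions on the vertices. -/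
structure IsConformalStructure (K : AbstractSimplicialComplex V) (U : Set (V → ℝ))
    (C : (V → ℝ) → V → V → ℝ) : Prop where
  isOpen : IsOpen U
  smooth : ∀ i j, IsEdge K i j → ContDiffOn ℝ ∞ (fun f => C f i j) U
  isMetric : ∀ f ∈ U, IsMetric K (C f)
  partialDeriv_len : ∀ i j, IsEdge K i j → ∀ f ∈ U,
    partialDeriv (fun g => len (C g) i j) i f = C f i j
  partialDeriv_eq_zero : ∀ i j, IsEdge K i j → ∀ k, k ≠ i → k ≠ j → ∀ f ∈ U,
    partialDeriv (fun g => C g i j) k f = 0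

/-- `q_ij = ∂d_ij/∂f_j` for the conformal structure `d = C[f]`. -/
noncomputable def qCoeff (C : (V → ℝ) → V → V → ℝ) (f : V → ℝ) (i j : V) : ℝ :=
  partialDeriv (fun g => C g i j) j f

/-- The sphere packing conformal structure `d_ij = e^{f_i}`. -/
noncomputable def spherePacking (f : V → ℝ) : V → V → ℝ := fun i _ => Real.exp (f i)

/-- The domain of the sphere packing conformal structure: all `f` that give a metric. -/
def spherePackingDomain (K : AbstractSimplicialComplex V) : Set (V → ℝ) :=
  {f | IsMetric K (spherePacking f)}

/-- `F` is convex on `S`, where `S` need not be a convex set: at each point of `S` the function `F`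
is smooth and its second variation along every line is nonnegative, and `F` is convex in the usual
sense on each convex subset of `S`. -/
def IsConvexFunctionalOn (F : (V → ℝ) → ℝ) (S : Set (V → ℝ)) : Prop :=
  (∀ f ∈ S, ContDiffAt ℝ ∞ F f ∧
    ∀ v : V → ℝ, 0 ≤ iteratedDeriv 2 (fun t : ℝ => F (f + t • v)) 0) ∧
  ∀ A ⊆ S, Convex ℝ A → ConvexOn ℝ A F

end Curvature

end PiecewiseFlat

/-! Restrict the functional to a line `f + t • v`. By Schläfli's formula the variations of the
dihedral angles drop out of the first derivative, which is therefore the sum of `deficit * (d_ij v_i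
+ d_ji v_j)` over the edges, that is, of `K_i v_i` over the vertices. In the second derivative the
variation of `d` contributes `∑ K_i v_i²` minus the sum of `deficit * q_ij * (v_i - v_j)²`. This
uses `q_ij = q_ji`, the symmetry of the mixed partials of `ℓ_ij`. The variation of the angles
contributes, inside each tetrahedron, a graph Laplacian with weights `2 * dualArea / ℓ_ij`
(`IsSplitOn.sum_dihedralVar_mul`). Its off-diagonal entries come from a polynomial identity and its
diagonal ones from scale invariance of angles. Together (`IsRegularConformal.iteratedDeriv_two_EHR`)
the second variation is `∑ K_i v_i²` plus a Laplacian with weights `(ℓ*_ij - q_ij K_ij / 2) / ℓ_ij`.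

For a general conformal structure these weights are assumed positive. For sphere packings `q = 0`,
but the dual areas can be negative, for instance when a small sphere nearly sinks into the plane of
the centers of the other three. Still, the Laplacian of each single tetrahedron is nonnegative
(`packForm_nonneg`): the weights at the sphere of largest curvature are positive, and eliminating
that vertex by the star-triangle transformation leaves a triangle with nonnegative weights.

All the geometry is polynomial in the squared lengths `s` and in `c_ij = 2 ℓ_ij d_ij`, up to
`√volSq`, a factor common to the six edges of a tetrahedron. -/

namespace PiecewiseFlat

/-! ### Algebra of squared lengths: dihedral angles and Schläfli's identity -/

section Algebra

variable {V : Type*}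

/-- Sixteen times the squared area of a triangle with squared edge lengths `s`. -/
def areaSq (s : V → V → ℝ) (i j k : V) : ℝ :=
  4 * (s i j * s i k) - (s i j + s i k - s j k) ^ 2

/-- The polarization of `areaSq`: its derivative at `s` in the direction `u`. -/
def areaSqDeriv (s u : V → V → ℝ) (i j k : V) : ℝ :=
  4 * (u i j * s i k + s i j * u i k) -
    2 * (s i j + s i k - s j k) * (u i j + u i k - u j k)

/-- The numerator of the cosine of the dihedral angle at `{i, j}`. -/
def cosNum (s : V → V → ℝ) (i j k l : V) : ℝ :=
  2 * s i j * (s i k + s i l - s k l) - (s i j + s i k - s j k) * (s i j + s i l - s j l)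

/-- The derivative of `cosNum` at `s` in the direction `u`. -/
def cosNumDeriv (s u : V → V → ℝ) (i j k l : V) : ℝ :=
  2 * u i j * (s i k + s i l - s k l) + 2 * s i j * (u i k + u i l - u k l) -
    ((u i j + u i k - u j k) * (s i j + s i l - s j l) +
      (s i j + s i k - s j k) * (u i j + u i l - u j l))

/-- Sixteen times the Gram determinant of a tetrahedron with squared edge lengths `s`. -/
def volSq (s : V → V → ℝ) (i j k l : V) : ℝ :=
  16 * (s i j * s i k * s i l) +
    4 * ((s i j + s i k - s j k) * (s i j + s i l - s j l) * (s i k + s i l - s k l)) -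
    4 * (s i j * (s i k + s i l - s k l) ^ 2 + s i k * (s i j + s i l - s j l) ^ 2 +
      s i l * (s i j + s i k - s j k) ^ 2)

/-- The derivative of the dihedral angle at `{i, j}` in the direction `u`, up to the positive
factor `ℓ_ij * √volSq`. -/
noncomputable def dihedralVar (s u : V → V → ℝ) (i j k l : V) : ℝ :=
  -(cosNumDeriv s u i j k l - cosNum s i j k l / 2 *
    (areaSqDeriv s u i j k / areaSq s i j k + areaSqDeriv s u i j l / areaSq s i j l))

variable {s u : V → V → ℝ}

/-- Jacobi's identity for the minors of the Gram matrix. It turns `1 - cos²` of the dihedral angle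
into a multiple of the squared volume. -/
theorem areaSq_mul_areaSq_sub (s : V → V → ℝ) (i j k l : V) :
    areaSq s i j k * areaSq s i j l - cosNum s i j k l ^ 2 = s i j * volSq s i j k l := by
  unfold areaSq cosNum volSq; ring

theorem areaSq_swap₁ (hs : ∀ i j, s i j = s j i) (i j k : V) : areaSq s j i k = areaSq s i j k := by
  unfold areaSq; rw [hs j i]; ring

theorem areaSq_swap₂ (hs : ∀ i j, s i j = s j i) (i j k : V) : areaSq s i k j = areaSq s i j k := by
  unfold areaSq; rw [hs k j]; ring

theorem areaSqDeriv_swap₁ (hs : ∀ i j, s i j = s j i) (hu : ∀ i j, u i j = u j i) (i j k : V) :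
    areaSqDeriv s u j i k = areaSqDeriv s u i j k := by
  unfold areaSqDeriv; rw [hs j i, hu j i]; ring

theorem areaSqDeriv_swap₂ (hs : ∀ i j, s i j = s j i) (hu : ∀ i j, u i j = u j i) (i j k : V) :
    areaSqDeriv s u i k j = areaSqDeriv s u i j k := by
  unfold areaSqDeriv; rw [hs k j, hu k j]; ring

theorem cosNum_swap₁ (hs : ∀ i j, s i j = s j i) (i j k l : V) :
    cosNum s j i k l = cosNum s i j k l := by
  unfold cosNum; rw [hs j i]; ring

theorem cosNum_swap₂ (hs : ∀ i j, s i j = s j i) (i j k l : V) :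
    cosNum s i j l k = cosNum s i j k l := by
  unfold cosNum; rw [hs l k]; ring

theorem volSq_swap₃ (hs : ∀ i j, s i j = s j i) (i j k l : V) :
    volSq s i j l k = volSq s i j k l := by
  unfold volSq; rw [hs l k]; ring

/-- The area of a face is the sum of the signed projected areas of the other three faces. -/
theorem cosNum_add_cosNum (hs : ∀ i j, s i j = s j i) (i j k l : V) :
    cosNum s i j k l + cosNum s i k j l + cosNum s j k i l = areaSq s i j k := by
  unfold cosNum areaSq; rw [hs k j, hs j i, hs k i]; ring

/-- Each edge lies in two faces, so adding `cosNum_add_cosNum` over the four faces and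
differentiating gives the factor 2. -/
theorem sum_cosNumDeriv (hs : ∀ i j, s i j = s j i) (hu : ∀ i j, u i j = u j i) (i j k l : V) :
    2 * (cosNumDeriv s u i j k l + cosNumDeriv s u i k j l + cosNumDeriv s u i l j k +
      cosNumDeriv s u j k i l + cosNumDeriv s u j l i k + cosNumDeriv s u k l i j) =
    areaSqDeriv s u i j k + areaSqDeriv s u i j l + areaSqDeriv s u i k l +
      areaSqDeriv s u j k l := by
  unfold cosNumDeriv areaSqDeriv
  rw [hs j i, hs k i, hs k j, hs l i, hs l j, hs l k, hu j i, hu k i, hu k j, hu l i, hu l j,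
    hu l k]
  ring

/-- The Schläfli identity. -/
theorem sum_dihedralVar (hs : ∀ i j, s i j = s j i) (hu : ∀ i j, u i j = u j i) {i j k l : V}
    (h₁ : areaSq s i j k ≠ 0) (h₂ : areaSq s i j l ≠ 0) (h₃ : areaSq s i k l ≠ 0)
    (h₄ : areaSq s j k l ≠ 0) :
    dihedralVar s u i j k l + dihedralVar s u i k j l + dihedralVar s u i l j k +
      dihedralVar s u j k i l + dihedralVar s u j l i k + dihedralVar s u k l i j = 0 := by
  have e := sum_cosNumDeriv hs hu i j k l
  have f₁ := cosNum_add_cosNum hs i j k l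
  have f₂ := cosNum_add_cosNum hs i j l k
  have f₃ := cosNum_add_cosNum hs i k l j
  have f₄ := cosNum_add_cosNum hs j k l i
  rw [cosNum_swap₂ hs i j k l] at f₂
  rw [cosNum_swap₂ hs i k j l, cosNum_swap₂ hs i l j k] at f₃
  rw [cosNum_swap₂ hs j k i l, cosNum_swap₂ hs j l i k, cosNum_swap₂ hs k l i j] at f₄
  have a₁ : areaSq s i k j = areaSq s i j k := areaSq_swap₂ hs ..
  have a₂ : areaSq s i l j = areaSq s i j l := areaSq_swap₂ hs ..
  have a₃ : areaSq s i l k = areaSq s i k l := areaSq_swap₂ hs ..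
  have a₄ : areaSq s j k i = areaSq s i j k := by rw [areaSq_swap₂ hs, areaSq_swap₁ hs]
  have a₅ : areaSq s j l i = areaSq s i j l := by rw [areaSq_swap₂ hs, areaSq_swap₁ hs]
  have a₆ : areaSq s j l k = areaSq s j k l := areaSq_swap₂ hs ..
  have a₇ : areaSq s k l i = areaSq s i k l := by rw [areaSq_swap₂ hs, areaSq_swap₁ hs]
  have a₈ : areaSq s k l j = areaSq s j k l := by rw [areaSq_swap₂ hs, areaSq_swap₁ hs]
  have b₁ : areaSqDeriv s u i k j = areaSqDeriv s u i j k := areaSqDeriv_swap₂ hs hu ..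
  have b₂ : areaSqDeriv s u i l j = areaSqDeriv s u i j l := areaSqDeriv_swap₂ hs hu ..
  have b₃ : areaSqDeriv s u i l k = areaSqDeriv s u i k l := areaSqDeriv_swap₂ hs hu ..
  have b₄ : areaSqDeriv s u j k i = areaSqDeriv s u i j k := by
    rw [areaSqDeriv_swap₂ hs hu, areaSqDeriv_swap₁ hs hu]
  have b₅ : areaSqDeriv s u j l i = areaSqDeriv s u i j l := by
    rw [areaSqDeriv_swap₂ hs hu, areaSqDeriv_swap₁ hs hu]
  have b₆ : areaSqDeriv s u j l k = areaSqDeriv s u j k l := areaSqDeriv_swap₂ hs hu ..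
  have b₇ : areaSqDeriv s u k l i = areaSqDeriv s u i k l := by
    rw [areaSqDeriv_swap₂ hs hu, areaSqDeriv_swap₁ hs hu]
  have b₈ : areaSqDeriv s u k l j = areaSqDeriv s u j k l := by
    rw [areaSqDeriv_swap₂ hs hu, areaSqDeriv_swap₁ hs hu]
  unfold dihedralVar
  rw [a₁, a₂, a₃, a₄, a₅, a₆, a₇, a₈, b₁, b₂, b₃, b₄, b₅, b₆, b₇, b₈]
  have g : ∀ x y : ℝ, y ≠ 0 → y * (x / y) = x := fun x y h => mul_div_cancel₀ x h
  have g₁ := g (areaSqDeriv s u i j k) _ h₁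
  have g₂ := g (areaSqDeriv s u i j l) _ h₂
  have g₃ := g (areaSqDeriv s u i k l) _ h₃
  have g₄ := g (areaSqDeriv s u j k l) _ h₄
  -- Collected by faces, the terms `cosNum / 2 * areaSqDeriv / areaSq` add up to half of
  -- `areaSqDeriv` for each face. This cancels the sum of the `cosNumDeriv` by `e`.
  linear_combination -(1 / 2) * e + areaSqDeriv s u i j k / areaSq s i j k / 2 * f₁ +
    areaSqDeriv s u i j l / areaSq s i j l / 2 * f₂ +
    areaSqDeriv s u i k l / areaSq s i k l / 2 * f₃ +
    areaSqDeriv s u j k l / areaSq s j k l / 2 * f₄ + (1 / 2) * (g₁ + g₂ + g₃ + g₄)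

/-- Dihedral angles are invariant under scaling. -/
theorem dihedralVar_self {i j k l : V} (h₁ : areaSq s i j k ≠ 0) (h₂ : areaSq s i j l ≠ 0) :
    dihedralVar s s i j k l = 0 := by
  have e : cosNumDeriv s s i j k l = 2 * cosNum s i j k l := by
    unfold cosNumDeriv cosNum; ring
  have f : ∀ m, areaSqDeriv s s i j m = 2 * areaSq s i j m := fun m => by
    unfold areaSqDeriv areaSq; ring
  unfold dihedralVar
  rw [e, f, f]
  field_simp
  ring

theorem dihedralVar_add (s u u' : V → V → ℝ) (i j k l : V) :
    dihedralVar s (fun a b => u a b + u' a b) i j k l =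
      dihedralVar s u i j k l + dihedralVar s u' i j k l := by
  unfold dihedralVar cosNumDeriv areaSqDeriv; ring

theorem dihedralVar_smul (s u : V → V → ℝ) (t : ℝ) (i j k l : V) :
    dihedralVar s (fun a b => t * u a b) i j k l = t * dihedralVar s u i j k l := by
  unfold dihedralVar cosNumDeriv areaSqDeriv; ring

end Algebra

/-! ### Polynomial identities behind the mixed second derivatives -/

section MixedAlgebra

/-- Division with remainder by the `areaSq` of the face `{i, j, k}`. Here `a, b, e, p, q, r` are the
squared lengths of `ij, ik, jk, il, jl, kl`, and `x, y` are `c_ij, c_ik`. The part not divisible by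
`areaSq` is the square of a height numerator. -/
theorem mixed_triangle (a b e p q r x y : ℝ) (ha : a ≠ 0) (he : e ≠ 0) :
    (4 * (x * b + a * y) - 2 * (a + b - e) * (x + y)) / 2 *
      ((2 * a * (b + p - r) - (a + b - e) * (a + p - q)) * (2 * a - x) / a +
        (2 * e * (a + q - p) - (e + a - b) * (e + q - r)) * (y - x + a + e - b) / e) =
    -2 * (2 * a * (b + p - r) - (a + b - e) * (a + p - q)) *
        (y * a - x * ((a + b - e) / 2)) ^ 2 / a ^ 2 +
      (4 * (a * b) - (a + b - e) ^ 2) * (1 / 2) *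
        ((2 * a * (b + p - r) - (a + b - e) * (a + p - q)) *
            ((y - x + a + e - b) * (y * a - x * ((a + b - e) / 2)) +
              x * ((2 * a - x) * e - (a + e - b) / 2 * (y - x + a + e - b))) / (a ^ 2 * e) +
          (4 * (x * b + a * y) - 2 * (a + b - e) * (x + y)) * ((a + q - p) / 2) *
            (y - x + a + e - b) / (a * e)) := by
  field_simp
  ring

/-- The quotients left by `mixed_triangle` on the faces `{i, j, k}` and `{i, j, l}`, together with
the derivatives of the cosine numerators, add up to the product of the two height numerators. The
new variable `z` is `c_il`. -/
theorem mixed_remainder (a b e p q r x y z : ℝ) (ha : a ≠ 0) (he : e ≠ 0) (hq : q ≠ 0) :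
    -((2 * a - x) / a * (2 * x * (b + p - r) + 2 * a * (y + z) -
          ((x + y) * (a + p - q) + (a + b - e) * (x + z))) +
        (y - x + a + e - b) / e * (2 * e * (x - z) - (x - y) * (e + q - r)) +
        (z - x + a + q - p) / q * (2 * q * (x - y) - (x - z) * (q + e - r))) +
      (1 / 2) * ((2 * a * (b + p - r) - (a + b - e) * (a + p - q)) *
            ((y - x + a + e - b) * (y * a - x * ((a + b - e) / 2)) +
              x * ((2 * a - x) * e - (a + e - b) / 2 * (y - x + a + e - b))) / (a ^ 2 * e) +
          (4 * (x * b + a * y) - 2 * (a + b - e) * (x + y)) * ((a + q - p) / 2) *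
            (y - x + a + e - b) / (a * e)) +
      (1 / 2) * ((2 * a * (p + b - r) - (a + p - q) * (a + b - e)) *
            ((z - x + a + q - p) * (z * a - x * ((a + p - q) / 2)) +
              x * ((2 * a - x) * q - (a + q - p) / 2 * (z - x + a + q - p))) / (a ^ 2 * q) +
          (4 * (x * p + a * z) - 2 * (a + p - q) * (x + z)) * ((a + e - b) / 2) *
            (z - x + a + q - p) / (a * q)) =
    4 * ((y * a - x * ((a + b - e) / 2)) * (z * a - x * ((a + p - q) / 2))) / a ^ 2 := by
  field_simp
  ring

end MixedAlgebra

/-! ### Off-diagonal entries of the Hessian of a tetrahedron -/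

section Mixed

variable {V : Type*}

/-- The numerator of the height `h_{ij,k}`, where `c i j = 2 ℓ_ij d_ij`. -/
noncomputable def heightNum (s c : V → V → ℝ) (i j k : V) : ℝ :=
  c i k * s i j - c i j * ((s i j + s i k - s j k) / 2)

/-- The part of the tetrahedron `{i, j, k, l}` dual to the edge `{i, j}`: up to a factor, the dual
area divided by the length of `{i, j}`. -/
noncomputable def dualRatio (s c : V → V → ℝ) (i j k l : V) : ℝ :=
  (2 * (heightNum s c i j k * heightNum s c i j l) - cosNum s i j k l *
    (heightNum s c i j k ^ 2 / areaSq s i j k + heightNum s c i j l ^ 2 / areaSq s i j l)) /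
    s i j ^ 2

/-- The variation of the squared lengths when the conformal parameter at `m` varies. -/
def vertexDir [DecidableEq V] (c : V → V → ℝ) (m : V) : V → V → ℝ := fun a b =>
  (if a = m then c a b else 0) + if b = m then c b a else 0

theorem vertexDir_symm [DecidableEq V] (c : V → V → ℝ) (m a b : V) :
    vertexDir c m a b = vertexDir c m b a := add_comm _ _

theorem vertexDir_left [DecidableEq V] (c : V → V → ℝ) {m b : V} (h : m ≠ b) :
    vertexDir c m m b = c m b := by simp [vertexDir, h.symm]

theorem vertexDir_right [DecidableEq V] (c : V → V → ℝ) {m b : V} (h : m ≠ b) :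
    vertexDir c m b m = c m b := by simp [vertexDir, h.symm]

theorem vertexDir_of_ne [DecidableEq V] (c : V → V → ℝ) {m a b : V} (ha : m ≠ a) (hb : m ≠ b) :
    vertexDir c m a b = 0 := by simp [vertexDir, ha.symm, hb.symm]

/-- Up to a factor, the left side is the derivative along `f_i` of the contribution of the
tetrahedron to `K_j`. The hypotheses on `c` solve the splitting and the compatibility conditions for
the entries at `j`. -/
theorem sum_dihedralVar_vertexDir [DecidableEq V] {s c : V → V → ℝ} (hs : ∀ i j, s i j = s j i)
    {i j k l : V} (hij : i ≠ j) (hik : i ≠ k) (hil : i ≠ l)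
    (sij : s i j ≠ 0) (sjk : s j k ≠ 0) (sjl : s j l ≠ 0)
    (h₁ : areaSq s i j k ≠ 0) (h₂ : areaSq s i j l ≠ 0)
    (cij : c j i = 2 * s i j - c i j)
    (cjk : c j k = c i k - c i j + s i j + s j k - s i k)
    (cjl : c j l = c i l - c i j + s i j + s j l - s i l) :
    c j i / s i j * dihedralVar s (vertexDir c i) i j k l +
      c j k / s j k * dihedralVar s (vertexDir c i) j k i l +
      c j l / s j l * dihedralVar s (vertexDir c i) j l i k = 2 * dualRatio s c i j k l := by
  have t₁ := mixed_triangle (s i j) (s i k) (s j k) (s i l) (s j l) (s k l) (c i j) (c i k) sij sjk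
  have t₂ := mixed_triangle (s i j) (s i l) (s j l) (s i k) (s j k) (s k l) (c i j) (c i l) sij sjl
  have r := mixed_remainder (s i j) (s i k) (s j k) (s i l) (s j l) (s k l) (c i j) (c i k) (c i l)
    sij sjk sjl
  have p₁ : areaSq s j k i = areaSq s i j k := by rw [areaSq_swap₂ hs, areaSq_swap₁ hs]
  have p₂ : areaSq s j l i = areaSq s i j l := by rw [areaSq_swap₂ hs, areaSq_swap₁ hs]
  have q₁ : areaSqDeriv s (vertexDir c i) j k i = areaSqDeriv s (vertexDir c i) i j k := by
    rw [areaSqDeriv_swap₂ hs (vertexDir_symm c i), areaSqDeriv_swap₁ hs (vertexDir_symm c i)]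
  have q₂ : areaSqDeriv s (vertexDir c i) j l i = areaSqDeriv s (vertexDir c i) i j l := by
    rw [areaSqDeriv_swap₂ hs (vertexDir_symm c i), areaSqDeriv_swap₁ hs (vertexDir_symm c i)]
  have d₁ : areaSqDeriv s (vertexDir c i) j k l = 0 := by
    unfold areaSqDeriv
    rw [vertexDir_of_ne c hij hik, vertexDir_of_ne c hij hil, vertexDir_of_ne c hik hil]; ring
  have d₂ : areaSqDeriv s (vertexDir c i) j l k = 0 := by
    rw [areaSqDeriv_swap₂ hs (vertexDir_symm c i), d₁]
  have e₁ : areaSqDeriv s (vertexDir c i) i j k = 4 * (c i j * s i k + s i j * c i k) -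
      2 * (s i j + s i k - s j k) * (c i j + c i k) := by
    unfold areaSqDeriv
    rw [vertexDir_of_ne c hij hik, vertexDir_left c hij, vertexDir_left c hik]; ring
  have e₂ : areaSqDeriv s (vertexDir c i) i j l = 4 * (c i j * s i l + s i j * c i l) -
      2 * (s i j + s i l - s j l) * (c i j + c i l) := by
    unfold areaSqDeriv
    rw [vertexDir_of_ne c hij hil, vertexDir_left c hij, vertexDir_left c hil]; ring
  have f₁ : cosNumDeriv s (vertexDir c i) i j k l = 2 * c i j * (s i k + s i l - s k l) +
      2 * s i j * (c i k + c i l) - ((c i j + c i k) * (s i j + s i l - s j l) +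
        (s i j + s i k - s j k) * (c i j + c i l)) := by
    unfold cosNumDeriv
    rw [vertexDir_of_ne c hij hik, vertexDir_of_ne c hij hil, vertexDir_of_ne c hik hil,
      vertexDir_left c hij, vertexDir_left c hik, vertexDir_left c hil]; ring
  have f₂ : cosNumDeriv s (vertexDir c i) j k i l = 2 * s j k * (c i j - c i l) -
      (c i j - c i k) * (s j k + s j l - s k l) := by
    unfold cosNumDeriv
    rw [vertexDir_of_ne c hij hik, vertexDir_of_ne c hij hil, vertexDir_of_ne c hik hil,
      vertexDir_right c hij, vertexDir_right c hik, vertexDir_left c hil]; ring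
  have f₃ : cosNumDeriv s (vertexDir c i) j l i k = 2 * s j l * (c i j - c i k) -
      (c i j - c i l) * (s j l + s j k - s k l) := by
    unfold cosNumDeriv
    rw [vertexDir_of_ne c hij hik, vertexDir_of_ne c hij hil, vertexDir_of_ne c hil hik,
      vertexDir_right c hij, vertexDir_right c hil, vertexDir_left c hik, hs l k]; ring
  have g₁ : cosNum s j k i l = 2 * s j k * (s i j + s j l - s i l) -
      (s j k + s i j - s i k) * (s j k + s j l - s k l) := by
    unfold cosNum; rw [hs j i, hs k i]
  have g₂ : cosNum s j l i k = 2 * s j l * (s i j + s j k - s i k) -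
      (s j l + s i j - s i l) * (s j l + s j k - s k l) := by
    unfold cosNum; rw [hs j i, hs l i, hs l k]
  unfold dualRatio dihedralVar heightNum
  rw [p₁, p₂, q₁, q₂, d₁, d₂, e₁, e₂, f₁, f₂, f₃, g₁, g₂, cij, cjk, cjl]
  generalize hP : areaSq s i j k = P at *
  generalize hQ : areaSq s i j l = Q at *
  have hP' : P = 4 * (s i j * s i k) - (s i j + s i k - s j k) ^ 2 := hP.symm
  have hQ' : Q = 4 * (s i j * s i l) - (s i j + s i l - s j l) ^ 2 := hQ.symm
  rw [← hP'] at t₁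
  rw [← hQ'] at t₂
  -- Only the faces `{i, j, k}` and `{i, j, l}` vary at first order. After division by their
  -- `areaSq` the remainders become the two quotients in `dualRatio`.
  have t₁' := congrArg (· / P) t₁
  have t₂' := congrArg (· / Q) t₂
  simp only [add_div, mul_div_right_comm _ _ P, mul_div_right_comm _ _ Q, div_self h₁,
    div_self h₂] at t₁' t₂'
  unfold cosNum
  linear_combination t₁' + t₂' + r

end Mixed

/-! ### The Hessian of one tetrahedron as a Laplacian -/

section Tetrahedron

variable {V : Type*}

theorem dihedralVar_swap₁ {s u : V → V → ℝ} (hs : ∀ i j, s i j = s j i)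
    (hu : ∀ i j, u i j = u j i) (i j k l : V) :
    dihedralVar s u j i k l = dihedralVar s u i j k l := by
  unfold dihedralVar
  rw [cosNum_swap₁ hs, areaSq_swap₁ hs i j k, areaSq_swap₁ hs i j l,
    areaSqDeriv_swap₁ hs hu i j k, areaSqDeriv_swap₁ hs hu i j l]
  congr 2
  unfold cosNumDeriv
  rw [hs j i, hu j i]
  ring

theorem dihedralVar_swap₂ {s u : V → V → ℝ} (hs : ∀ i j, s i j = s j i)
    (hu : ∀ i j, u i j = u j i) (i j k l : V) :
    dihedralVar s u i j l k = dihedralVar s u i j k l := by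
  unfold dihedralVar
  rw [cosNum_swap₂ hs, add_comm (areaSqDeriv s u i j l / _)]
  congr 2
  unfold cosNumDeriv
  rw [hs l k, hu l k]
  ring

theorem dihedralVar_congr (s : V → V → ℝ) {u u' : V → V → ℝ} {i j k l : V}
    (h₁ : u i j = u' i j) (h₂ : u i k = u' i k) (h₃ : u i l = u' i l) (h₄ : u j k = u' j k)
    (h₅ : u j l = u' j l) (h₆ : u k l = u' k l) :
    dihedralVar s u i j k l = dihedralVar s u' i j k l := by
  unfold dihedralVar cosNumDeriv areaSqDeriv
  rw [h₁, h₂, h₃, h₄, h₅, h₆]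

/-- The squared lengths `s` are nondegenerate on the vertices in `X`, and the splitting
`2 s_ij = c_ij + c_ji`, with `c_ij = 2 ℓ_ij d_ij`, comes from a metric `d`. -/
structure IsSplitOn (s c : V → V → ℝ) (X : Finset V) : Prop where
  symm : ∀ i j, s i j = s j i
  edge : ∀ i ∈ X, ∀ j ∈ X, i ≠ j → s i j ≠ 0 ∧ c i j + c j i = 2 * s i j
  triangle : ∀ i ∈ X, ∀ j ∈ X, ∀ k ∈ X, i ≠ j → i ≠ k → j ≠ k → areaSq s i j k ≠ 0 ∧
    c i j - c j i + (c j k - c k j) + (c k i - c i k) = 0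

namespace IsSplitOn

variable {s c : V → V → ℝ} {X : Finset V}

/-- Compatibility in the triangle is what makes the height over an edge the same seen from either
endpoint: the perpendiculars at the edge centers concur. -/
theorem heightNum_swap (h : IsSplitOn s c X) {i j k : V} (hi : i ∈ X) (hj : j ∈ X) (hk : k ∈ X) (hij : i ≠ j)
    (hik : i ≠ k) (hjk : j ≠ k) : heightNum s c j i k = heightNum s c i j k := by
  unfold heightNum
  have e₁ := (h.edge i hi j hj hij).2
  have e₂ := (h.edge i hi k hk hik).2
  have e₃ := (h.edge j hj k hk hjk).2
  have e₄ := (h.triangle i hi j hj k hk hij hik hjk).2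
  rw [h.symm j i]
  linear_combination (1 / 2) * s i j * e₄ - (1 / 2) * s i j * e₂ + (1 / 2) * s i j * e₃ -
    ((s i j + s j k - s i k) / 2) * e₁ + (1 / 2) * s i j * e₁

theorem dualRatio_swap₁ (h : IsSplitOn s c X) {i j k l : V} (hi : i ∈ X) (hj : j ∈ X) (hk : k ∈ X)
    (hl : l ∈ X) (hij : i ≠ j) (hik : i ≠ k) (hil : i ≠ l) (hjk : j ≠ k) (hjl : j ≠ l) :
    dualRatio s c j i k l = dualRatio s c i j k l := by
  unfold dualRatio
  rw [cosNum_swap₁ h.symm, areaSq_swap₁ h.symm i j k, areaSq_swap₁ h.symm i j l,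
    h.heightNum_swap hi hj hk hij hik hjk, h.heightNum_swap hi hj hl hij hil hjl, h.symm j i]

theorem sum_dihedralVar_vertexDir [DecidableEq V] (h : IsSplitOn s c X) {i j k l : V} (hi : i ∈ X)
    (hj : j ∈ X) (hk : k ∈ X) (hl : l ∈ X) (hij : i ≠ j) (hik : i ≠ k) (hil : i ≠ l) (hjk : j ≠ k)
    (hjl : j ≠ l) :
    c j i / s i j * dihedralVar s (vertexDir c i) i j k l +
      c j k / s j k * dihedralVar s (vertexDir c i) j k i l +
      c j l / s j l * dihedralVar s (vertexDir c i) j l i k = 2 * dualRatio s c i j k l := by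
  have e₁ := (h.edge i hi j hj hij).2
  refine PiecewiseFlat.sum_dihedralVar_vertexDir h.symm hij hik hil (h.edge i hi j hj hij).1
    (h.edge j hj k hk hjk).1 (h.edge j hj l hl hjl).1 (h.triangle i hi j hj k hk hij hik hjk).1
    (h.triangle i hi j hj l hl hij hil hjl).1 (by linarith) ?_ ?_
  · have e₂ := (h.edge i hi k hk hik).2
    have e₃ := (h.edge j hj k hk hjk).2
    have e₄ := (h.triangle i hi j hj k hk hij hik hjk).2
    linear_combination (1 / 2) * (e₁ - e₂ + e₃ + e₄)
  · have e₂ := (h.edge i hi l hl hil).2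
    have e₃ := (h.edge j hj l hl hjl).2
    have e₄ := (h.triangle i hi j hj l hl hij hil hjl).2
    linear_combination (1 / 2) * (e₁ - e₂ + e₃ + e₄)

/-- The four vertex directions add up to `2 s`, an infinitesimal scaling, which preserves angles.
This makes the rows of the Hessian sum to zero. -/
theorem sum_vertexDir_dihedralVar [DecidableEq V] (h : IsSplitOn s c X) {i j k l : V} (hi : i ∈ X)
    (hj : j ∈ X) (hk : k ∈ X) (hl : l ∈ X) (hij : i ≠ j) (hik : i ≠ k) (hil : i ≠ l) (hjk : j ≠ k)
    (hjl : j ≠ l) (hkl : k ≠ l) :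
    dihedralVar s (vertexDir c i) i j k l + dihedralVar s (vertexDir c j) i j k l +
      dihedralVar s (vertexDir c k) i j k l + dihedralVar s (vertexDir c l) i j k l = 0 := by
  rw [← dihedralVar_add, ← dihedralVar_add, ← dihedralVar_add,
    dihedralVar_congr s (u' := fun a b => 2 * s a b), dihedralVar_smul,
    dihedralVar_self (h.triangle i hi j hj k hk hij hik hjk).1
      (h.triangle i hi j hj l hl hij hil hjl).1, mul_zero]
  · linear_combination (h.edge i hi j hj hij).2 + vertexDir_left c hij +
      vertexDir_right c hij.symm + vertexDir_of_ne c hik.symm hjk.symm +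
      vertexDir_of_ne c hil.symm hjl.symm
  · linear_combination (h.edge i hi k hk hik).2 + vertexDir_left c hik +
      vertexDir_right c hik.symm + vertexDir_of_ne c hij.symm hjk +
      vertexDir_of_ne c hil.symm hkl.symm
  · linear_combination (h.edge i hi l hl hil).2 + vertexDir_left c hil +
      vertexDir_right c hil.symm + vertexDir_of_ne c hij.symm hjl +
      vertexDir_of_ne c hik.symm hkl
  · linear_combination (h.edge j hj k hk hjk).2 + vertexDir_left c hjk +
      vertexDir_right c hjk.symm + vertexDir_of_ne c hij hik +
      vertexDir_of_ne c hjl.symm hkl.symm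
  · linear_combination (h.edge j hj l hl hjl).2 + vertexDir_left c hjl +
      vertexDir_right c hjl.symm + vertexDir_of_ne c hij hil +
      vertexDir_of_ne c hjk.symm hkl
  · linear_combination (h.edge k hk l hl hkl).2 + vertexDir_left c hkl +
      vertexDir_right c hkl.symm + vertexDir_of_ne c hik hil +
      vertexDir_of_ne c hjk hjl

/-- The second variation of one tetrahedron under conformal changes, as a Laplacian. -/
theorem sum_dihedralVar_mul [DecidableEq V] (h : IsSplitOn s c X) {i j k l : V} (hi : i ∈ X)
    (hj : j ∈ X) (hk : k ∈ X) (hl : l ∈ X) (hij : i ≠ j) (hik : i ≠ k) (hil : i ≠ l) (hjk : j ≠ k)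
    (hjl : j ≠ l) (hkl : k ≠ l) (v : V → ℝ) {u : V → V → ℝ}
    (hu : ∀ a b, u a b = c a b * v a + c b a * v b) :
    dihedralVar s u i j k l * (u i j / s i j) +
      dihedralVar s u i k j l * (u i k / s i k) +
      dihedralVar s u i l j k * (u i l / s i l) +
      dihedralVar s u j k i l * (u j k / s j k) +
      dihedralVar s u j l i k * (u j l / s j l) +
      dihedralVar s u k l i j * (u k l / s k l) =
    -2 * (dualRatio s c i j k l * (v i - v j) ^ 2 +
      dualRatio s c i k j l * (v i - v k) ^ 2 +
      dualRatio s c i l j k * (v i - v l) ^ 2 +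
      dualRatio s c j k i l * (v j - v k) ^ 2 +
      dualRatio s c j l i k * (v j - v l) ^ 2 +
      dualRatio s c k l i j * (v k - v l) ^ 2) := by
  -- Linearity in the direction: `u` is the combination of the vertex directions with coefficients
  -- `v`.
  have exp : ∀ a ∈ X, ∀ b ∈ X, ∀ d ∈ X, ∀ e ∈ X, a ≠ b → a ≠ d → a ≠ e → b ≠ d → b ≠ e → d ≠ e →
      dihedralVar s u a b d e = v a * dihedralVar s (vertexDir c a) a b d e +
        v b * dihedralVar s (vertexDir c b) a b d e + v d * dihedralVar s (vertexDir c d) a b d e +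
        v e * dihedralVar s (vertexDir c e) a b d e := by
    intro a ha b hb d hd e he hab had hae hbd hbe hde
    rw [← dihedralVar_smul, ← dihedralVar_smul, ← dihedralVar_smul, ← dihedralVar_smul,
      ← dihedralVar_add, ← dihedralVar_add, ← dihedralVar_add]
    apply dihedralVar_congr <;> rw [hu]
    · rw [vertexDir_left c hab, vertexDir_right c hab.symm, vertexDir_of_ne c had.symm hbd.symm,
        vertexDir_of_ne c hae.symm hbe.symm]; ring
    · rw [vertexDir_left c had, vertexDir_right c had.symm, vertexDir_of_ne c hab.symm hbd,
        vertexDir_of_ne c hae.symm hde.symm]; ring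
    · rw [vertexDir_left c hae, vertexDir_right c hae.symm, vertexDir_of_ne c hab.symm hbe,
        vertexDir_of_ne c had.symm hde]; ring
    · rw [vertexDir_left c hbd, vertexDir_right c hbd.symm, vertexDir_of_ne c hab had,
        vertexDir_of_ne c hbe.symm hde.symm]; ring
    · rw [vertexDir_left c hbe, vertexDir_right c hbe.symm, vertexDir_of_ne c hab hae,
        vertexDir_of_ne c hbd.symm hde]; ring
    · rw [vertexDir_left c hde, vertexDir_right c hde.symm, vertexDir_of_ne c had hae,
        vertexDir_of_ne c hbd hbe]; ring
  have zij := h.sum_vertexDir_dihedralVar hi hj hk hl hij hik hil hjk hjl hkl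
  have zik := h.sum_vertexDir_dihedralVar hi hk hj hl hik hij hil hjk.symm hkl hjl
  have zil := h.sum_vertexDir_dihedralVar hi hl hj hk hil hij hik hjl.symm hkl.symm hjk
  have zjk := h.sum_vertexDir_dihedralVar hj hk hi hl hjk hij.symm hjl hik.symm hkl hil
  have zjl := h.sum_vertexDir_dihedralVar hj hl hi hk hjl hij.symm hjk hil.symm hkl.symm hik
  have zkl := h.sum_vertexDir_dihedralVar hk hl hi hj hkl hik.symm hjk.symm hil.symm hjl.symm hij
  have xij := h.sum_dihedralVar_vertexDir hi hj hk hl hij hik hil hjk hjl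
  have xik := h.sum_dihedralVar_vertexDir hi hk hj hl hik hij hil hjk.symm hkl
  have xil := h.sum_dihedralVar_vertexDir hi hl hj hk hil hij hik hjl.symm hkl.symm
  have xji := h.sum_dihedralVar_vertexDir hj hi hk hl hij.symm hjk hjl hik hil
  have xjk := h.sum_dihedralVar_vertexDir hj hk hi hl hjk hij.symm hjl hik.symm hkl
  have xjl := h.sum_dihedralVar_vertexDir hj hl hi hk hjl hij.symm hjk hil.symm hkl.symm
  have xki := h.sum_dihedralVar_vertexDir hk hi hj hl hik.symm hjk.symm hkl hij hil
  have xkj := h.sum_dihedralVar_vertexDir hk hj hi hl hjk.symm hik.symm hkl hij.symm hjl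
  have xkl := h.sum_dihedralVar_vertexDir hk hl hi hj hkl hik.symm hjk.symm hil.symm hjl.symm
  have xli := h.sum_dihedralVar_vertexDir hl hi hj hk hil.symm hjl.symm hkl.symm hij hik
  have xlj := h.sum_dihedralVar_vertexDir hl hj hi hk hjl.symm hil.symm hkl.symm hij.symm hjk
  have xlk := h.sum_dihedralVar_vertexDir hl hk hi hj hkl.symm hil.symm hjl.symm hik.symm hjk.symm
  -- The rewrites below bring the twelve star relations to the same six angles and six weights.
  have s₁ := fun m => dihedralVar_swap₁ h.symm (vertexDir_symm c m)
  have s₂ := fun m => dihedralVar_swap₂ h.symm (vertexDir_symm c m)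
  rw [s₁ i j k i l,
    h.symm k j] at xik
  rw [s₁ i j l i k,
    s₁ i k l i j,
    h.symm l j,
    h.symm l k] at xil
  rw [s₁ j i j k l,
    h.dualRatio_swap₁ hi hj hk hl hij hik hil hjk hjl,
    h.symm j i] at xji
  rw [s₁ j i k j l,
    s₂ j k l i j,
    h.symm k i] at xjk
  rw [s₁ j i l j k,
    s₁ j k l j i,
    s₂ j k l i j,
    h.symm l i,
    h.symm l k] at xjl
  rw [s₁ k i k j l,
    s₂ k i l j k,
    h.dualRatio_swap₁ hi hk hj hl hik hij hil hjk.symm hkl,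
    h.symm k i] at xki
  rw [s₁ k j k i l,
    s₁ k i j k l,
    s₂ k j l i k,
    h.dualRatio_swap₁ hj hk hi hl hjk hij.symm hjl hik.symm hkl,
    h.symm k j,
    h.symm j i] at xkj
  rw [s₁ k i l k j,
    s₂ k i l j k,
    s₁ k j l k i,
    s₂ k j l i k,
    h.symm l i,
    h.symm l j] at xkl
  rw [s₁ l i l j k,
    s₂ l i j k l,
    s₂ l i k j l,
    h.dualRatio_swap₁ hi hl hj hk hil hij hik hjl.symm hkl.symm,
    h.symm l i] at xli
  rw [s₁ l j l i k,
    s₁ l i j l k,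
    s₂ l i j k l,
    s₂ l j k i l,
    h.dualRatio_swap₁ hj hl hi hk hjl hij.symm hjk hil.symm hkl.symm,
    h.symm l j,
    h.symm j i] at xlj
  rw [s₁ l k l i j,
    s₁ l i k l j,
    s₂ l i k j l,
    s₁ l j k l i,
    s₂ l j k i l,
    h.dualRatio_swap₁ hk hl hi hj hkl hik.symm hjk.symm hil.symm hjl.symm,
    h.symm l k,
    h.symm k i,
    h.symm k j] at xlk
  rw [exp _ hi _ hj _ hk _ hl hij hik hil hjk hjl hkl,
    exp _ hi _ hk _ hj _ hl hik hij hil hjk.symm hkl hjl,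
    exp _ hi _ hl _ hj _ hk hil hij hik hjl.symm hkl.symm hjk,
    exp _ hj _ hk _ hi _ hl hjk hij.symm hjl hik.symm hkl hil,
    exp _ hj _ hl _ hi _ hk hjl hij.symm hjk hil.symm hkl.symm hik,
    exp _ hk _ hl _ hi _ hj hkl hik.symm hjk.symm hil.symm hjl.symm hij,
    hu i j, hu i k, hu i l, hu j k, hu j l, hu k l]
  -- The star relation at `b` in direction `a` gives the entry of `v a * v b`. The relations `z`,
  -- weighted by `v b ^ 2`, make the diagonal entry at `b` minus the sum of the others, hence the
  -- coefficient `v a * v b - v b ^ 2`.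
  linear_combination (v i * v j - v j ^ 2) * xij +
    (v i * v k - v k ^ 2) * xik +
    (v i * v l - v l ^ 2) * xil +
    (v j * v i - v i ^ 2) * xji +
    (v j * v k - v k ^ 2) * xjk +
    (v j * v l - v l ^ 2) * xjl +
    (v k * v i - v i ^ 2) * xki +
    (v k * v j - v j ^ 2) * xkj +
    (v k * v l - v l ^ 2) * xkl +
    (v l * v i - v i ^ 2) * xli +
    (v l * v j - v j ^ 2) * xlj +
    (v l * v k - v k ^ 2) * xlk +
    v i ^ 2 * (c i j / s i j) * zij +
    v i ^ 2 * (c i k / s i k) * zik +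
    v i ^ 2 * (c i l / s i l) * zil +
    v j ^ 2 * (c j i / s i j) * zij +
    v j ^ 2 * (c j k / s j k) * zjk +
    v j ^ 2 * (c j l / s j l) * zjl +
    v k ^ 2 * (c k i / s i k) * zik +
    v k ^ 2 * (c k j / s j k) * zjk +
    v k ^ 2 * (c k l / s k l) * zkl +
    v l ^ 2 * (c l i / s i l) * zil +
    v l ^ 2 * (c l j / s j l) * zjl +
    v l ^ 2 * (c l k / s k l) * zkl

end IsSplitOn

end Tetrahedron

/-! ### Angles, heights and dual areas in terms of squared lengths -/

section Trigonometry

variable {V : Type*}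

/-- The squared edge lengths. -/
def sqLen (d : V → V → ℝ) (i j : V) : ℝ := len d i j ^ 2

/-- The quantities `2 ℓ_ij d_ij`. -/
def splitting (d : V → V → ℝ) (i j : V) : ℝ := 2 * len d i j * d i j

theorem len_comm (d : V → V → ℝ) (i j : V) : len d i j = len d j i := add_comm _ _

theorem sqLen_comm (d : V → V → ℝ) (i j : V) : sqLen d i j = sqLen d j i := by
  unfold sqLen; rw [len_comm]

variable {d : V → V → ℝ} {i j k l : V}

theorem angle_arg_sq (hij : 0 < len d i j) (hik : 0 < len d i k) :
    1 - ((len d i j ^ 2 + len d i k ^ 2 - len d j k ^ 2) / (2 * len d i j * len d i k)) ^ 2 =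
      areaSq (sqLen d) i j k / (2 * len d i j * len d i k) ^ 2 := by
  unfold areaSq sqLen
  field_simp
  ring

theorem cos_angle (hij : 0 < len d i j) (hik : 0 < len d i k) (hP : 0 < areaSq (sqLen d) i j k) :
    Real.cos (angle d i j k) =
      (sqLen d i j + sqLen d i k - sqLen d j k) / (2 * len d i j * len d i k) := by
  have h : 0 ≤ 1 -
      ((len d i j ^ 2 + len d i k ^ 2 - len d j k ^ 2) / (2 * len d i j * len d i k)) ^ 2 := by
    rw [angle_arg_sq hij hik]; positivity
  have h' := abs_le_of_sq_le_sq' (a := (len d i j ^ 2 + len d i k ^ 2 - len d j k ^ 2) /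
    (2 * len d i j * len d i k)) (b := 1) (by linarith) zero_le_one
  exact Real.cos_arccos h'.1 h'.2

theorem sin_angle (hij : 0 < len d i j) (hik : 0 < len d i k) :
    Real.sin (angle d i j k) = √(areaSq (sqLen d) i j k) / (2 * len d i j * len d i k) := by
  unfold angle
  rw [Real.sin_arccos, angle_arg_sq hij hik, Real.sqrt_div' _ (by positivity),
    Real.sqrt_sq (by positivity)]

theorem dihedral_eq_arccos (hij : 0 < len d i j) (hik : 0 < len d i k) (hil : 0 < len d i l)
    (hk : 0 < areaSq (sqLen d) i j k) (hl : 0 < areaSq (sqLen d) i j l)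
    (hkl : 0 < areaSq (sqLen d) i k l) :
    dihedral d i j k l = Real.arccos (cosNum (sqLen d) i j k l /
      (√(areaSq (sqLen d) i j k) * √(areaSq (sqLen d) i j l))) := by
  unfold dihedral
  rw [cos_angle hik hil hkl, cos_angle hij hik hk, cos_angle hij hil hl, sin_angle hij hik,
    sin_angle hij hil]
  have h₁ := Real.sqrt_pos.2 hk
  have h₂ := Real.sqrt_pos.2 hl
  congr 1
  generalize √(areaSq (sqLen d) i j k) = A at *
  generalize √(areaSq (sqLen d) i j l) = B at *
  unfold cosNum sqLen
  field_simp

/-- The sine of the dihedral angle, as a function of its cosine. -/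
theorem sqrt_one_sub_cosNum_sq (hij : 0 < len d i j) (hk : 0 < areaSq (sqLen d) i j k)
    (hl : 0 < areaSq (sqLen d) i j l) :
    √(1 - (cosNum (sqLen d) i j k l /
      (√(areaSq (sqLen d) i j k) * √(areaSq (sqLen d) i j l))) ^ 2) =
      len d i j * √(volSq (sqLen d) i j k l) /
        (√(areaSq (sqLen d) i j k) * √(areaSq (sqLen d) i j l)) := by
  have e := areaSq_mul_areaSq_sub (sqLen d) i j k l
  have h₁ := Real.sqrt_pos.2 hk
  have h₂ := Real.sqrt_pos.2 hl
  have e₁ : 1 - (cosNum (sqLen d) i j k l /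
      (√(areaSq (sqLen d) i j k) * √(areaSq (sqLen d) i j l))) ^ 2 =
      len d i j ^ 2 * volSq (sqLen d) i j k l /
        (√(areaSq (sqLen d) i j k) * √(areaSq (sqLen d) i j l)) ^ 2 := by
    have : len d i j ^ 2 = sqLen d i j := rfl
    rw [this, ← e, mul_pow, div_pow, mul_pow, Real.sq_sqrt hk.le, Real.sq_sqrt hl.le]
    field_simp
  rw [e₁, Real.sqrt_div' _ (by positivity), Real.sqrt_mul (by positivity),
    Real.sqrt_sq hij.le, Real.sqrt_sq (by positivity)]

/-- Positive volume makes the sine positive. Strictness is needed since `arccos` is not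
differentiable at `±1`. -/
theorem cosNum_div_mem_Ioo (hij : 0 < len d i j) (hk : 0 < areaSq (sqLen d) i j k)
    (hl : 0 < areaSq (sqLen d) i j l) (hD : 0 < volSq (sqLen d) i j k l) :
    cosNum (sqLen d) i j k l / (√(areaSq (sqLen d) i j k) * √(areaSq (sqLen d) i j l)) ∈
      Set.Ioo (-1) 1 := by
  have h : 0 < √(1 - (cosNum (sqLen d) i j k l /
      (√(areaSq (sqLen d) i j k) * √(areaSq (sqLen d) i j l))) ^ 2) := by
    rw [sqrt_one_sub_cosNum_sq hij hk hl]
    have h₁ := Real.sqrt_pos.2 hk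
    have h₂ := Real.sqrt_pos.2 hl
    have h₃ := Real.sqrt_pos.2 hD
    positivity
  have h' := Real.sqrt_pos.1 h
  exact ⟨(abs_lt_of_sq_lt_sq' (by linarith) zero_le_one).1,
    (abs_lt_of_sq_lt_sq' (by linarith) zero_le_one).2⟩

theorem height₂_eq (hij : 0 < len d i j) (hik : 0 < len d i k)
    (hk : 0 < areaSq (sqLen d) i j k) :
    height₂ d i j k = heightNum (sqLen d) (splitting d) i j k /
      (len d i j * √(areaSq (sqLen d) i j k)) := by
  unfold height₂
  rw [cos_angle hij hik hk, sin_angle hij hik]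
  have h₁ := Real.sqrt_pos.2 hk
  generalize √(areaSq (sqLen d) i j k) = A at *
  unfold heightNum splitting sqLen
  field_simp

theorem height₃_eq (hij : 0 < len d i j) (hik : 0 < len d i k) (hil : 0 < len d i l)
    (hk : 0 < areaSq (sqLen d) i j k) (hl : 0 < areaSq (sqLen d) i j l)
    (hkl : 0 < areaSq (sqLen d) i k l) (hD : 0 < volSq (sqLen d) i j k l) :
    height₃ d i j k l = (heightNum (sqLen d) (splitting d) i j l * areaSq (sqLen d) i j k -
      heightNum (sqLen d) (splitting d) i j k * cosNum (sqLen d) i j k l) /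
      (len d i j ^ 2 * √(areaSq (sqLen d) i j k) * √(volSq (sqLen d) i j k l)) := by
  have hx := cosNum_div_mem_Ioo hij hk hl hD
  unfold height₃
  rw [dihedral_eq_arccos hij hik hil hk hl hkl, Real.cos_arccos hx.1.le hx.2.le, Real.sin_arccos,
    sqrt_one_sub_cosNum_sq hij hk hl, height₂_eq hij hik hk, height₂_eq hij hil hl]
  have h₁ := Real.sqrt_pos.2 hk
  have h₂ := Real.sqrt_pos.2 hl
  have h₃ := Real.sqrt_pos.2 hD
  have e : areaSq (sqLen d) i j k = √(areaSq (sqLen d) i j k) ^ 2 := (Real.sq_sqrt hk.le).symm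
  generalize √(areaSq (sqLen d) i j k) = A at *
  rw [e]
  field_simp

/-- The roots of the face areas occur in pairs and cancel. Only `√volSq` survives, which is the same
for all six edges. -/
theorem dualArea_eq (hij : 0 < len d i j) (hik : 0 < len d i k) (hil : 0 < len d i l)
    (hk : 0 < areaSq (sqLen d) i j k) (hl : 0 < areaSq (sqLen d) i j l)
    (hkl : 0 < areaSq (sqLen d) i k l) (hD : 0 < volSq (sqLen d) i j k l) :
    dualArea d i j k l = len d i j * dualRatio (sqLen d) (splitting d) i j k l /
      (2 * √(volSq (sqLen d) i j k l)) := by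
  have s := sqLen_comm d
  unfold dualArea
  rw [height₃_eq hij hik hil hk hl hkl hD, height₃_eq hij hil hik hl hk
    (by rwa [areaSq_swap₂ s]) (by rwa [volSq_swap₃ s]),
    height₂_eq hij hik hk, height₂_eq hij hil hl, cosNum_swap₂ s i j k l,
    volSq_swap₃ s i j k l]
  have h₁ := Real.sqrt_pos.2 hk
  have h₂ := Real.sqrt_pos.2 hl
  have h₃ := Real.sqrt_pos.2 hD
  have e₁ : areaSq (sqLen d) i j k = √(areaSq (sqLen d) i j k) ^ 2 := (Real.sq_sqrt hk.le).symm
  have e₂ : areaSq (sqLen d) i j l = √(areaSq (sqLen d) i j l) ^ 2 := (Real.sq_sqrt hl.le).symm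
  have e₃ : sqLen d i j = len d i j ^ 2 := rfl
  unfold dualRatio
  generalize √(areaSq (sqLen d) i j k) = A at *
  generalize √(areaSq (sqLen d) i j l) = B at *
  rw [e₁, e₂, e₃]
  field_simp
  ring

end Trigonometry

/-! ### Differentiating dihedral angles -/

section Nondegenerate

variable {V : Type*}

/-- The simplices with vertices in `X` are nondegenerate for the edge lengths of `d`. -/
structure IsNondegenerateOn (d : V → V → ℝ) (X : Finset V) : Prop where
  len_pos : ∀ i ∈ X, ∀ j ∈ X, i ≠ j → 0 < len d i j
  areaSq_pos : ∀ i ∈ X, ∀ j ∈ X, ∀ k ∈ X, i ≠ j → i ≠ k → j ≠ k → 0 < areaSq (sqLen d) i j k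
  volSq_pos : ∀ i ∈ X, ∀ j ∈ X, ∀ k ∈ X, ∀ l ∈ X, i ≠ j → i ≠ k → i ≠ l → j ≠ k → j ≠ l → k ≠ l →
    0 < volSq (sqLen d) i j k l

theorem hasDerivAt_areaSq {s : ℝ → V → V → ℝ} {u : V → V → ℝ} {t : ℝ} {i j k : V}
    (hij : HasDerivAt (fun t => s t i j) (u i j) t) (hik : HasDerivAt (fun t => s t i k) (u i k) t)
    (hjk : HasDerivAt (fun t => s t j k) (u j k) t) :
    HasDerivAt (fun t => areaSq (s t) i j k) (areaSqDeriv (s t) u i j k) t := by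
  unfold areaSq areaSqDeriv
  refine (((hij.fun_mul hik).const_mul 4).fun_sub
    (((hij.fun_add hik).fun_sub hjk).fun_pow 2)).congr_deriv ?_
  push_cast
  ring

theorem hasDerivAt_cosNum {s : ℝ → V → V → ℝ} {u : V → V → ℝ} {t : ℝ} {i j k l : V}
    (hij : HasDerivAt (fun t => s t i j) (u i j) t) (hik : HasDerivAt (fun t => s t i k) (u i k) t)
    (hil : HasDerivAt (fun t => s t i l) (u i l) t) (hjk : HasDerivAt (fun t => s t j k) (u j k) t)
    (hjl : HasDerivAt (fun t => s t j l) (u j l) t)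
    (hkl : HasDerivAt (fun t => s t k l) (u k l) t) :
    HasDerivAt (fun t => cosNum (s t) i j k l) (cosNumDeriv (s t) u i j k l) t := by
  unfold cosNum cosNumDeriv
  exact ((hij.const_mul 2).fun_mul ((hik.fun_add hil).fun_sub hkl)).fun_sub
    (((hij.fun_add hik).fun_sub hjk).fun_mul ((hij.fun_add hil).fun_sub hjl))

/-- The chain rule for `arccos` of `cosNum` over the root of the product of the two `areaSq`.
Dividing by the sine from `sqrt_one_sub_cosNum_sq` cancels the roots of the areas and explains the
normalization of `dihedralVar`. -/
theorem hasDerivAt_dihedral {d : ℝ → V → V → ℝ} {w u : V → V → ℝ} {t : ℝ} {X : Finset V}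
    (hX : IsNondegenerateOn (d t) X)
    (hd : ∀ i ∈ X, ∀ j ∈ X, i ≠ j → HasDerivAt (fun t => len (d t) i j) (w i j) t)
    (hu : ∀ i ∈ X, ∀ j ∈ X, i ≠ j → u i j = 2 * len (d t) i j * w i j) {i j k l : V} (hi : i ∈ X)
    (hj : j ∈ X) (hk : k ∈ X) (hl : l ∈ X) (hij : i ≠ j) (hik : i ≠ k) (hil : i ≠ l) (hjk : j ≠ k)
    (hjl : j ≠ l) (hkl : k ≠ l) :
    HasDerivAt (fun t => dihedral (d t) i j k l)
      (dihedralVar (sqLen (d t)) u i j k l /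
        (len (d t) i j * √(volSq (sqLen (d t)) i j k l))) t := by
  have hs : ∀ a ∈ X, ∀ b ∈ X, a ≠ b → HasDerivAt (fun t => sqLen (d t) a b) (u a b) t := by
    intro a ha b hb hab
    rw [hu a ha b hb hab]
    refine ((hd a ha b hb hab).fun_pow 2).congr_deriv ?_
    push_cast
    ring
  have hA : ∀ a ∈ X, ∀ b ∈ X, ∀ e ∈ X, a ≠ b → a ≠ e → b ≠ e →
      HasDerivAt (fun t => areaSq (sqLen (d t)) a b e) (areaSqDeriv (sqLen (d t)) u a b e) t :=
    fun a ha b hb e he h₁ h₂ h₃ => hasDerivAt_areaSq (s := fun t => sqLen (d t))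
      (hs a ha b hb h₁) (hs a ha e he h₂) (hs b hb e he h₃)
  have hN : HasDerivAt (fun t => cosNum (sqLen (d t)) i j k l)
      (cosNumDeriv (sqLen (d t)) u i j k l) t :=
    hasDerivAt_cosNum (s := fun t => sqLen (d t)) (hs i hi j hj hij) (hs i hi k hk hik)
      (hs i hi l hl hil) (hs j hj k hk hjk) (hs j hj l hl hjl) (hs k hk l hl hkl)
  have hk' := hX.areaSq_pos i hi j hj k hk hij hik hjk
  have hl' := hX.areaSq_pos i hi j hj l hl hij hil hjl
  have hkl' := hX.areaSq_pos i hi k hk l hl hik hil hkl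
  have hD := hX.volSq_pos i hi j hj k hk l hl hij hik hil hjk hjl hkl
  have hL := hX.len_pos i hi j hj hij
  -- The closed form needs positive lengths and areas, which are open conditions and so persist near
  -- `t`.
  have hev : (fun t => dihedral (d t) i j k l) =ᶠ[nhds t] fun t =>
      Real.arccos (cosNum (sqLen (d t)) i j k l /
        (√(areaSq (sqLen (d t)) i j k) * √(areaSq (sqLen (d t)) i j l))) := by
    filter_upwards [(hd i hi j hj hij).continuousAt.eventually_const_lt hL,
      (hd i hi k hk hik).continuousAt.eventually_const_lt (hX.len_pos i hi k hk hik),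
      (hd i hi l hl hil).continuousAt.eventually_const_lt (hX.len_pos i hi l hl hil),
      (hA i hi j hj k hk hij hik hjk).continuousAt.eventually_const_lt hk',
      (hA i hi j hj l hl hij hil hjl).continuousAt.eventually_const_lt hl',
      (hA i hi k hk l hl hik hil hkl).continuousAt.eventually_const_lt hkl']
      with t' h₁ h₂ h₃ h₄ h₅ h₆
    exact dihedral_eq_arccos h₁ h₂ h₃ h₄ h₅ h₆
  have hx := cosNum_div_mem_Ioo hL hk' hl' hD
  have hAk := (hA i hi j hj k hk hij hik hjk).sqrt hk'.ne'
  have hAl := (hA i hi j hj l hl hij hil hjl).sqrt hl'.ne'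
  have h₁ := Real.sqrt_pos.2 hk'
  have h₂ := Real.sqrt_pos.2 hl'
  have h₃ := Real.sqrt_pos.2 hD
  have hq := hN.fun_div (hAk.fun_mul hAl) (mul_pos h₁ h₂).ne'
  refine HasDerivAt.congr_of_eventuallyEq ?_ hev
  refine ((Real.hasDerivAt_arccos hx.1.ne' hx.2.ne).comp t hq).congr_deriv ?_
  rw [sqrt_one_sub_cosNum_sq hL hk' hl']
  unfold dihedralVar
  have e₁ : areaSq (sqLen (d t)) i j k = √(areaSq (sqLen (d t)) i j k) ^ 2 :=
    (Real.sq_sqrt hk'.le).symm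
  have e₂ : areaSq (sqLen (d t)) i j l = √(areaSq (sqLen (d t)) i j l) ^ 2 :=
    (Real.sq_sqrt hl'.le).symm
  generalize √(areaSq (sqLen (d t)) i j k) = A at *
  generalize √(areaSq (sqLen (d t)) i j l) = B at *
  rw [e₁, e₂]
  field_simp

theorem contDiffAt_dihedral {E : Type*} [NormedAddCommGroup E] [NormedSpace ℝ E]
    {d : E → V → V → ℝ} {x : E} {X : Finset V} (hX : IsNondegenerateOn (d x) X)
    (hd : ∀ i ∈ X, ∀ j ∈ X, i ≠ j → ContDiffAt ℝ ∞ (fun x => len (d x) i j) x) {i j k l : V}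
    (hi : i ∈ X) (hj : j ∈ X) (hk : k ∈ X) (hl : l ∈ X) (hij : i ≠ j) (hik : i ≠ k) (hil : i ≠ l)
    (hjk : j ≠ k) (hjl : j ≠ l) (hkl : k ≠ l) :
    ContDiffAt ℝ ∞ (fun x => dihedral (d x) i j k l) x := by
  have hs : ∀ a ∈ X, ∀ b ∈ X, a ≠ b → ContDiffAt ℝ ∞ (fun x => sqLen (d x) a b) x :=
    fun a ha b hb hab => (hd a ha b hb hab).pow 2
  have hA : ∀ a ∈ X, ∀ b ∈ X, ∀ e ∈ X, a ≠ b → a ≠ e → b ≠ e →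
      ContDiffAt ℝ ∞ (fun x => areaSq (sqLen (d x)) a b e) x := by
    intro a ha b hb e he h₁ h₂ h₃
    have := hs a ha b hb h₁
    have := hs a ha e he h₂
    have := hs b hb e he h₃
    unfold areaSq
    fun_prop
  have hN : ContDiffAt ℝ ∞ (fun x => cosNum (sqLen (d x)) i j k l) x := by
    have := hs i hi j hj hij
    have := hs i hi k hk hik
    have := hs i hi l hl hil
    have := hs j hj k hk hjk
    have := hs j hj l hl hjl
    have := hs k hk l hl hkl
    unfold cosNum
    fun_prop
  have hk' := hX.areaSq_pos i hi j hj k hk hij hik hjk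
  have hl' := hX.areaSq_pos i hi j hj l hl hij hil hjl
  have hkl' := hX.areaSq_pos i hi k hk l hl hik hil hkl
  have hD := hX.volSq_pos i hi j hj k hk l hl hij hik hil hjk hjl hkl
  have hL := hX.len_pos i hi j hj hij
  have hev : (fun x => dihedral (d x) i j k l) =ᶠ[nhds x] fun x =>
      Real.arccos (cosNum (sqLen (d x)) i j k l /
        (√(areaSq (sqLen (d x)) i j k) * √(areaSq (sqLen (d x)) i j l))) := by
    filter_upwards [(hd i hi j hj hij).continuousAt.eventually_const_lt hL,
      (hd i hi k hk hik).continuousAt.eventually_const_lt (hX.len_pos i hi k hk hik),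
      (hd i hi l hl hil).continuousAt.eventually_const_lt (hX.len_pos i hi l hl hil),
      (hA i hi j hj k hk hij hik hjk).continuousAt.eventually_const_lt hk',
      (hA i hi j hj l hl hij hil hjl).continuousAt.eventually_const_lt hl',
      (hA i hi k hk l hl hik hil hkl).continuousAt.eventually_const_lt hkl']
      with x' h₁ h₂ h₃ h₄ h₅ h₆
    exact dihedral_eq_arccos h₁ h₂ h₃ h₄ h₅ h₆
  have hx := cosNum_div_mem_Ioo hL hk' hl' hD
  refine ContDiffAt.congr_of_eventuallyEq ?_ hev
  have hq : ContDiffAt ℝ ∞ (fun x => cosNum (sqLen (d x)) i j k l /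
      (√(areaSq (sqLen (d x)) i j k) * √(areaSq (sqLen (d x)) i j l))) x :=
    hN.div (((hA i hi j hj k hk hij hik hjk).sqrt hk'.ne').mul
      ((hA i hi j hj l hl hij hil hjl).sqrt hl'.ne'))
      (mul_pos (Real.sqrt_pos.2 hk') (Real.sqrt_pos.2 hl')).ne'
  exact ContDiffAt.comp (g := Real.arccos) x (Real.contDiffAt_arccos hx.1.ne' hx.2.ne) hq

end Nondegenerate

/-! ### Nonnegativity of the Laplacian of four tangent spheres -/

section SpherePackingForm

/-- A weighted Laplacian on four vertices is nonnegative if the star at one vertex dominates. -/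
theorem laplacian_nonneg_of_star {a b c p q r : ℝ} (ha : 0 < a) (hb : 0 < b) (hc : 0 < c)
    (hp : 0 ≤ p * (a + b + c) + a * b) (hq : 0 ≤ q * (a + b + c) + a * c)
    (hr : 0 ≤ r * (a + b + c) + b * c) (w x y z : ℝ) :
    0 ≤ a * (w - x) ^ 2 + b * (w - y) ^ 2 + c * (w - z) ^ 2 + p * (x - y) ^ 2 +
      q * (x - z) ^ 2 + r * (y - z) ^ 2 := by
  -- Star-triangle transformation: completing the square in `w` leaves a Laplacian on the other
  -- three vertices.
  have h : (a + b + c) * (a * (w - x) ^ 2 + b * (w - y) ^ 2 + c * (w - z) ^ 2 + p * (x - y) ^ 2 +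
      q * (x - z) ^ 2 + r * (y - z) ^ 2) = (a * (w - x) + b * (w - y) + c * (w - z)) ^ 2 +
      (p * (a + b + c) + a * b) * (x - y) ^ 2 + (q * (a + b + c) + a * c) * (x - z) ^ 2 +
      (r * (a + b + c) + b * c) * (y - z) ^ 2 := by ring
  refine nonneg_of_mul_nonneg_right (a := a + b + c) ?_ (by positivity)
  rw [h]
  positivity

/-- Four mutually tangent spheres with these curvatures have noncoplanar centers iff this is
positive (Descartes). -/
def descartes (w x y z : ℝ) : ℝ := (w + x + y + z) ^ 2 - 2 * (w ^ 2 + x ^ 2 + y ^ 2 + z ^ 2)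

/-- The weight of the edge joining the spheres of curvatures `w` and `x`. -/
def packWeight (w x y z : ℝ) : ℝ :=
  w * x * (((x + y + z - w) ^ 2 + descartes w x y z) * ((w + y + z - x) ^ 2 + descartes w x y z)) *
    (descartes w x y z + (w + x + z - y) * (w + x + y - z))

/-- The Laplacian with weights `packWeight`. -/
def packForm (w x y z : ℝ) (a b c d : ℝ) : ℝ :=
  packWeight w x y z * (a - b) ^ 2 + packWeight w y x z * (a - c) ^ 2 +
    packWeight w z x y * (a - d) ^ 2 + packWeight x y w z * (b - c) ^ 2 +
    packWeight x z w y * (b - d) ^ 2 + packWeight y z w x * (c - d) ^ 2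

/-- After elimination of `w`, this is the numerator of the weight between `x` and `y`. It factors
into positive terms and a quintic whose only terms of unclear sign carry the factor `w - z`. -/
theorem packWeight_star {w x y z : ℝ} (hw : 0 < w) (hx : 0 < x) (hy : 0 < y) (hz : 0 < z)
    (hzw : z ≤ w) (hD : 0 < descartes w x y z) :
    0 ≤ packWeight x y w z * (packWeight w x y z + packWeight w y x z + packWeight w z x y) +
      packWeight w x y z * packWeight w y x z := by
  have e : packWeight x y w z * (packWeight w x y z + packWeight w y x z + packWeight w z x y) +
      packWeight w x y z * packWeight w y x z = 16 * (w * x * y *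
        (((x + y + z - w) ^ 2 + descartes w x y z) * ((w + y + z - x) ^ 2 + descartes w x y z) *
          ((w + x + z - y) ^ 2 + descartes w x y z)) * descartes w x y z) *
      (3*w^2*x^2*y + 3*w^2*x^2*z + 3*w^2*x*y^2 + 4*w^2*x*y*z + w^2*x*z^2 + 3*w^2*y^2*z + w^2*y*z^2 +
        3*w*x^2*y^2 + 7*w*x^2*y*z + 2*w*x^2*z^2 + 7*w*x*y^2*z + 7*w*x*y*z^2 + 2*w*y^2*z^2 +
        4*x^2*y^2*z + 2*x^2*y*z^2 + 2*x*y^2*z^2 + 2*w*x*z^2*(w-z) + 2*w*y*z^2*(w-z) +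
        2*x*y*z*(w-z)*(w+z)) := by
    unfold packWeight descartes
    ring
  have h : 0 ≤ w - z := sub_nonneg.2 hzw
  rw [e]
  positivity

/-- If `w` is the largest curvature, the last factor of each weight at `w` is `descartes` plus a
product of positive numbers, so the star at `w` has positive weights. -/
theorem packForm_nonneg_of_max {w x y z : ℝ} (hw : 0 < w) (hx : 0 < x) (hy : 0 < y) (hz : 0 < z)
    (hxw : x ≤ w) (hyw : y ≤ w) (hzw : z ≤ w) (hD : 0 < descartes w x y z) (a b c d : ℝ) :
    0 ≤ packForm w x y z a b c d := by
  have s₁ : ∀ w x y z, packWeight w x z y = packWeight w x y z := by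
    intros; unfold packWeight descartes; ring
  have d₁ : descartes w x z y = descartes w x y z := by unfold descartes; ring
  have d₂ : descartes w y z x = descartes w x y z := by unfold descartes; ring
  have d₃ : descartes w y x z = descartes w x y z := by unfold descartes; ring
  have d₄ : descartes w z x y = descartes w x y z := by unfold descartes; ring
  have hx' : 0 < w + y + z - x := by linarith
  have hy' : 0 < w + x + z - y := by linarith
  have hz' : 0 < w + x + y - z := by linarith
  refine laplacian_nonneg_of_star ?_ ?_ ?_ (packWeight_star hw hx hy hz hzw hD) ?_ ?_ a b c d
  · unfold packWeight; positivity
  · unfold packWeight; rw [d₃, add_right_comm w y x]; positivity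
  · unfold packWeight; rw [d₄, add_right_comm w z x, add_right_comm w z y]; positivity
  · have := packWeight_star hw hx hz hy hyw (by rwa [d₁])
    rw [s₁ w x y z] at this
    linarith
  · have := packWeight_star hw hy hz hx hxw (by rwa [d₂])
    rw [s₁ w y x z, s₁ w z x y] at this
    linarith

theorem packForm_nonneg {w x y z : ℝ} (hw : 0 < w) (hx : 0 < x) (hy : 0 < y) (hz : 0 < z)
    (hD : 0 < descartes w x y z) (a b c d : ℝ) : 0 ≤ packForm w x y z a b c d := by
  have s₁ : ∀ w x y z a b c d, packForm x w y z b a c d = packForm w x y z a b c d := by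
    intros; unfold packForm packWeight descartes; ring
  have s₂ : ∀ w x y z a b c d, packForm y x w z c b a d = packForm w x y z a b c d := by
    intros; unfold packForm packWeight descartes; ring
  have s₃ : ∀ w x y z a b c d, packForm z x y w d b c a = packForm w x y z a b c d := by
    intros; unfold packForm packWeight descartes; ring
  have d₁ : descartes x w y z = descartes w x y z := by unfold descartes; ring
  have d₂ : descartes y x w z = descartes w x y z := by unfold descartes; ring
  have d₃ : descartes z x y w = descartes w x y z := by unfold descartes; ring
  -- The form is invariant under relabeling, so the largest curvature may be moved to the first
  -- place.
  by_cases h₁ : x ≤ w ∧ y ≤ w ∧ z ≤ w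
  · exact packForm_nonneg_of_max hw hx hy hz h₁.1 h₁.2.1 h₁.2.2 hD ..
  by_cases h₂ : w ≤ x ∧ y ≤ x ∧ z ≤ x
  · rw [← s₁]
    exact packForm_nonneg_of_max hx hw hy hz h₂.1 h₂.2.1 h₂.2.2 (d₁ ▸ hD) ..
  by_cases h₃ : x ≤ y ∧ w ≤ y ∧ z ≤ y
  · rw [← s₂]
    exact packForm_nonneg_of_max hy hx hw hz h₃.1 h₃.2.1 h₃.2.2 (d₂ ▸ hD) ..
  · rw [← s₃]
    have h₄ : x ≤ z ∧ y ≤ z ∧ w ≤ z := by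
      refine ⟨?_, ?_, ?_⟩ <;> by_contra! <;> grind
    exact packForm_nonneg_of_max hz hx hy hw h₄.1 h₄.2.1 h₄.2.2 (d₃ ▸ hD) ..

end SpherePackingForm

/-! ### Second variation of one tetrahedron of a metric -/

section Tetrahedra

variable {V : Type*}

/-- Since `ℓ_ij (d_ij - d_ji) = d_ij² - d_ji²`, the quadratic compatibility condition becomes linear
in `splitting`. -/
theorem isSplitOn_of_isNondegenerateOn {d : V → V → ℝ} {X : Finset V} (hX : IsNondegenerateOn d X)
    (hd : ∀ i ∈ X, ∀ j ∈ X, ∀ k ∈ X, i ≠ j → i ≠ k → j ≠ k →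
      d i j ^ 2 + d j k ^ 2 + d k i ^ 2 = d j i ^ 2 + d i k ^ 2 + d k j ^ 2) :
    IsSplitOn (sqLen d) (splitting d) X where
  symm := sqLen_comm d
  edge i hi j hj hij := by
    refine ⟨(pow_pos (hX.len_pos i hi j hj hij) 2).ne', ?_⟩
    unfold splitting sqLen len
    ring
  triangle i hi j hj k hk hij hik hjk := by
    refine ⟨(hX.areaSq_pos i hi j hj k hk hij hik hjk).ne', ?_⟩
    unfold splitting len
    linear_combination 2 * hd i hi j hj k hk hij hik hjk

/-- The sum over the six edges of the tetrahedron `{i, j, k, l}`. -/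
def edgeSum (F : V → V → V → V → ℝ) (i j k l : V) : ℝ :=
  F i j k l + F i k j l + F i l j k + F j k i l + F j l i k + F k l i j

/-- The derivative of the dihedral angle at `{i, j}` in the conformal direction `v`. -/
noncomputable def dihedralRate (d : V → V → ℝ) (v : V → ℝ) (i j k l : V) : ℝ :=
  dihedralVar (sqLen d) (fun a b => splitting d a b * v a + splitting d b a * v b) i j k l /
    (len d i j * √(volSq (sqLen d) i j k l))

theorem volSq_perm (d : V → V → ℝ) (i j k l : V) :
    volSq (sqLen d) i k j l = volSq (sqLen d) i j k l ∧
    volSq (sqLen d) i l j k = volSq (sqLen d) i j k l ∧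
    volSq (sqLen d) j k i l = volSq (sqLen d) i j k l ∧
    volSq (sqLen d) j l i k = volSq (sqLen d) i j k l ∧
    volSq (sqLen d) k l i j = volSq (sqLen d) i j k l := by
  have s := sqLen_comm d
  unfold volSq
  rw [s j i, s k i, s k j, s l i, s l j, s l k]
  refine ⟨?_, ?_, ?_, ?_, ?_⟩ <;> ring

variable {d : V → V → ℝ} {X : Finset V} {i j k l : V}

/-- The Schläfli formula. -/
theorem edgeSum_dihedralRate_mul_len (hX : IsNondegenerateOn d X) (v : V → ℝ) (hi : i ∈ X)
    (hj : j ∈ X) (hk : k ∈ X) (hl : l ∈ X) (hij : i ≠ j) (hik : i ≠ k) (hil : i ≠ l) (hjk : j ≠ k)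
    (hjl : j ≠ l) (hkl : k ≠ l) :
    edgeSum (fun i j k l => dihedralRate d v i j k l * len d i j) i j k l = 0 := by
  obtain ⟨e₁, e₂, e₃, e₄, e₅⟩ := volSq_perm d i j k l
  have h := sum_dihedralVar (sqLen_comm d)
    (u := fun a b => splitting d a b * v a + splitting d b a * v b) (fun a b => add_comm _ _)
    (hX.areaSq_pos i hi j hj k hk hij hik hjk).ne' (hX.areaSq_pos i hi j hj l hl hij hil hjl).ne'
    (hX.areaSq_pos i hi k hk l hl hik hil hkl).ne' (hX.areaSq_pos j hj k hk l hl hjk hjl hkl).ne'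
  have l₁ := hX.len_pos i hi j hj hij
  have l₂ := hX.len_pos i hi k hk hik
  have l₃ := hX.len_pos i hi l hl hil
  have l₄ := hX.len_pos j hj k hk hjk
  have l₅ := hX.len_pos j hj l hl hjl
  have l₆ := hX.len_pos k hk l hl hkl
  have hD := Real.sqrt_pos.2 (hX.volSq_pos i hi j hj k hk l hl hij hik hil hjk hjl hkl)
  unfold edgeSum dihedralRate
  beta_reduce
  rw [e₁, e₂, e₃, e₄, e₅]
  field_simp
  linear_combination h

/-- The second variation of one tetrahedron. -/
theorem edgeSum_dihedralRate_mul [DecidableEq V] (hX : IsNondegenerateOn d X)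
    (hd : ∀ i ∈ X, ∀ j ∈ X, ∀ k ∈ X, i ≠ j → i ≠ k → j ≠ k →
      d i j ^ 2 + d j k ^ 2 + d k i ^ 2 = d j i ^ 2 + d i k ^ 2 + d k j ^ 2) (v : V → ℝ) (hi : i ∈ X)
    (hj : j ∈ X) (hk : k ∈ X) (hl : l ∈ X) (hij : i ≠ j) (hik : i ≠ k) (hil : i ≠ l) (hjk : j ≠ k)
    (hjl : j ≠ l) (hkl : k ≠ l) :
    edgeSum (fun i j k l => dihedralRate d v i j k l * (d i j * v i + d j i * v j)) i j k l =
      edgeSum (fun i j k l => -(2 * (dualArea d i j k l / len d i j) * (v i - v j) ^ 2))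
        i j k l := by
  obtain ⟨e₁, e₂, e₃, e₄, e₅⟩ := volSq_perm d i j k l
  have h := (isSplitOn_of_isNondegenerateOn hX hd).sum_dihedralVar_mul hi hj hk hl hij hik hil hjk
    hjl hkl v (u := fun a b => splitting d a b * v a + splitting d b a * v b) fun a b => rfl
  have hD := Real.sqrt_pos.2 (hX.volSq_pos i hi j hj k hk l hl hij hik hil hjk hjl hkl)
  have A : ∀ a ∈ X, ∀ b ∈ X, ∀ e ∈ X, ∀ f ∈ X, a ≠ b → a ≠ e → a ≠ f → b ≠ e → b ≠ f → e ≠ f →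
      dualArea d a b e f / len d a b = dualRatio (sqLen d) (splitting d) a b e f /
        (2 * √(volSq (sqLen d) a b e f)) := by
    intro a ha b hb e he f hf hab hae haf hbe hbf hef
    have := hX.len_pos a ha b hb hab
    rw [dualArea_eq this (hX.len_pos a ha e he hae) (hX.len_pos a ha f hf haf)
      (hX.areaSq_pos a ha b hb e he hab hae hbe) (hX.areaSq_pos a ha b hb f hf hab haf hbf)
      (hX.areaSq_pos a ha e he f hf hae haf hef)
      (hX.volSq_pos a ha b hb e he f hf hab hae haf hbe hbf hef)]
    field_simp
  -- The length varies at the rate of the squared length divided by `2 ℓ`; with the `ℓ` in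
  -- `dihedralRate` this yields the denominator `sqLen`.
  have B : ∀ a ∈ X, ∀ b ∈ X, ∀ e f, a ≠ b →
      dihedralRate d v a b e f * (d a b * v a + d b a * v b) = dihedralVar (sqLen d)
        (fun a b => splitting d a b * v a + splitting d b a * v b) a b e f *
        ((splitting d a b * v a + splitting d b a * v b) / sqLen d a b) /
          (2 * √(volSq (sqLen d) a b e f)) := by
    intro a ha b hb e f hab
    have := hX.len_pos a ha b hb hab
    unfold dihedralRate
    have e : splitting d a b * v a + splitting d b a * v b =
      2 * len d a b * (d a b * v a + d b a * v b) := by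
      unfold splitting; rw [len_comm d b a]; ring
    rw [e]
    unfold sqLen
    field_simp
  unfold edgeSum
  beta_reduce
  rw [A _ hi _ hj _ hk _ hl hij hik hil hjk hjl hkl,
    A _ hi _ hk _ hj _ hl hik hij hil hjk.symm hkl hjl,
    A _ hi _ hl _ hj _ hk hil hij hik hjl.symm hkl.symm hjk,
    A _ hj _ hk _ hi _ hl hjk hij.symm hjl hik.symm hkl hil,
    A _ hj _ hl _ hi _ hk hjl hij.symm hjk hil.symm hkl.symm hik,
    A _ hk _ hl _ hi _ hj hkl hik.symm hjk.symm hil.symm hjl.symm hij,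
    B _ hi _ hj _ _ hij, B _ hi _ hk _ _ hik, B _ hi _ hl _ _ hil, B _ hj _ hk _ _ hjk,
    B _ hj _ hl _ _ hjl, B _ hk _ hl _ _ hkl, e₁, e₂, e₃, e₄, e₅]
  linear_combination h / (2 * √(volSq (sqLen d) i j k l))

/-- The definition uses the spherical triangle at `i`; the closed form in squared lengths is
symmetric in the endpoints. -/
theorem dihedral_swap₁ (hX : IsNondegenerateOn d X) (hi : i ∈ X)
    (hj : j ∈ X) (hk : k ∈ X) (hl : l ∈ X) (hij : i ≠ j) (hik : i ≠ k) (hil : i ≠ l) (hjk : j ≠ k)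
    (hjl : j ≠ l) (hkl : k ≠ l) : dihedral d j i k l = dihedral d i j k l := by
  have s := sqLen_comm d
  rw [dihedral_eq_arccos (hX.len_pos i hi j hj hij) (hX.len_pos i hi k hk hik)
    (hX.len_pos i hi l hl hil) (hX.areaSq_pos i hi j hj k hk hij hik hjk)
    (hX.areaSq_pos i hi j hj l hl hij hil hjl) (hX.areaSq_pos i hi k hk l hl hik hil hkl),
    dihedral_eq_arccos (hX.len_pos j hj i hi hij.symm) (hX.len_pos j hj k hk hjk)
    (hX.len_pos j hj l hl hjl) (hX.areaSq_pos j hj i hi k hk hij.symm hjk hik)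
    (hX.areaSq_pos j hj i hi l hl hij.symm hjl hil) (hX.areaSq_pos j hj k hk l hl hjk hjl hkl),
    cosNum_swap₁ s, areaSq_swap₁ s i j k, areaSq_swap₁ s i j l]

/-! ### Tetrahedra of mutually tangent spheres -/

section SpherePacking

variable {r : V → ℝ}

theorem areaSq_pack (h : ∀ i j, d i j = r i) (i j k : V) :
    areaSq (sqLen d) i j k = 16 * (r i * r j * r k * (r i + r j + r k)) := by
  unfold areaSq sqLen len
  simp only [h]
  ring

/-- Here the center of a triangle is its incenter, and every height is the inradius. -/
theorem heightNum_pack (h : ∀ i j, d i j = r i) (i j k : V) :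
    heightNum (sqLen d) (splitting d) i j k = 4 * (r i * r j * r k) * (r i + r j) := by
  unfold heightNum splitting sqLen len
  simp only [h]
  ring

theorem volSq_pack (h : ∀ i j, d i j = r i) (hr : ∀ i, 0 < r i) (i j k l : V) :
    volSq (sqLen d) i j k l = 64 * (r i * r j * r k * r l) ^ 2 *
      descartes (r i)⁻¹ (r j)⁻¹ (r k)⁻¹ (r l)⁻¹ := by
  have := hr i
  have := hr j
  have := hr k
  have := hr l
  unfold volSq sqLen len descartes
  simp only [h]
  field_simp
  ring

theorem dualRatio_pack (h : ∀ i j, d i j = r i) (hr : ∀ i, 0 < r i) (i j k l : V) :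
    dualRatio (sqLen d) (splitting d) i j k l =
      8 * (r i * r j) * (2 * (r k * r l) ^ 2 + (r i + r j) * (r k * r l) * (r k + r l) -
        r i * r j * (r k - r l) ^ 2) / ((r i + r j + r k) * (r i + r j + r l)) := by
  have := hr i
  have := hr j
  have := hr k
  have := hr l
  unfold dualRatio
  rw [heightNum_pack h, heightNum_pack h, areaSq_pack h, areaSq_pack h]
  unfold cosNum sqLen len
  simp only [h]
  field_simp
  ring

/-- The factor split off is symmetric in the four radii, hence common to all edges. For this the
weight is multiplied by the perimeters of the two faces not containing the edge, which are the first
two factors in parentheses in `packWeight`, up to constants and radii. -/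
theorem packWeight_inv {a b x y : ℝ} (ha : 0 < a) (hb : 0 < b) (hx : 0 < x) (hy : 0 < y) :
    8 * (a * b) * (2 * (x * y) ^ 2 + (a + b) * (x * y) * (x + y) - a * b * (x - y) ^ 2) /
      ((a + b + x) * (a + b + y)) = packWeight a⁻¹ b⁻¹ x⁻¹ y⁻¹ * ((a * b * x * y) ^ 4 /
        (4 * ((a + b + x) * (a + b + y) * (a + x + y) * (b + x + y)))) := by
  unfold packWeight descartes
  field_simp
  ring

theorem edgeSum_dualArea_pack_nonneg (hX : IsNondegenerateOn d X) (h : ∀ i j, d i j = r i)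
    (hr : ∀ i, 0 < r i) (v : V → ℝ) (hi : i ∈ X)
    (hj : j ∈ X) (hk : k ∈ X) (hl : l ∈ X) (hij : i ≠ j) (hik : i ≠ k) (hil : i ≠ l) (hjk : j ≠ k)
    (hjl : j ≠ l) (hkl : k ≠ l) :
    0 ≤ edgeSum (fun i j k l => dualArea d i j k l / len d i j * (v i - v j) ^ 2) i j k l := by
  obtain ⟨e₁, e₂, e₃, e₄, e₅⟩ := volSq_perm d i j k l
  have hD' := hX.volSq_pos i hi j hj k hk l hl hij hik hil hjk hjl hkl
  have hD := Real.sqrt_pos.2 hD'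
  have A : ∀ a ∈ X, ∀ b ∈ X, ∀ e ∈ X, ∀ f ∈ X, a ≠ b → a ≠ e → a ≠ f → b ≠ e → b ≠ f → e ≠ f →
      dualArea d a b e f / len d a b = packWeight (r a)⁻¹ (r b)⁻¹ (r e)⁻¹ (r f)⁻¹ *
        ((r a * r b * r e * r f) ^ 4 / (4 * ((r a + r b + r e) * (r a + r b + r f) *
          (r a + r e + r f) * (r b + r e + r f)))) / (2 * √(volSq (sqLen d) a b e f)) := by
    intro a ha b hb e he f hf hab hae haf hbe hbf hef
    have := hX.len_pos a ha b hb hab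
    rw [← packWeight_inv (hr a) (hr b) (hr e) (hr f), ← dualRatio_pack h hr,
      dualArea_eq this (hX.len_pos a ha e he hae) (hX.len_pos a ha f hf haf)
      (hX.areaSq_pos a ha b hb e he hab hae hbe) (hX.areaSq_pos a ha b hb f hf hab haf hbf)
      (hX.areaSq_pos a ha e he f hf hae haf hef)
      (hX.volSq_pos a ha b hb e he f hf hab hae haf hbe hbf hef)]
    field_simp
  unfold edgeSum
  beta_reduce
  rw [A _ hi _ hj _ hk _ hl hij hik hil hjk hjl hkl,
    A _ hi _ hk _ hj _ hl hik hij hil hjk.symm hkl hjl,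
    A _ hi _ hl _ hj _ hk hil hij hik hjl.symm hkl.symm hjk,
    A _ hj _ hk _ hi _ hl hjk hij.symm hjl hik.symm hkl hil,
    A _ hj _ hl _ hi _ hk hjl hij.symm hjk hil.symm hkl.symm hik,
    A _ hk _ hl _ hi _ hj hkl hik.symm hjk.symm hil.symm hjl.symm hij, e₁, e₂, e₃, e₄, e₅]
  have := hr i
  have := hr j
  have := hr k
  have := hr l
  rw [volSq_pack h hr] at hD'
  -- Nondegeneracy of the tetrahedron is Descartes' inequality for the curvatures.
  have hQ := pos_of_mul_pos_right hD' (by positivity)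
  have key := packForm_nonneg (inv_pos.2 (hr i)) (inv_pos.2 (hr j)) (inv_pos.2 (hr k))
    (inv_pos.2 (hr l)) hQ (v i) (v j) (v k) (v l)
  have key' : 0 ≤ packForm (r i)⁻¹ (r j)⁻¹ (r k)⁻¹ (r l)⁻¹ (v i) (v j) (v k) (v l) *
      ((r i * r j * r k * r l) ^ 4 / (4 * ((r i + r j + r k) * (r i + r j + r l) *
        (r i + r k + r l) * (r j + r k + r l))) / (2 * √(volSq (sqLen d) i j k l))) := by
    positivity
  refine key'.trans_eq ?_
  unfold packForm
  ring

end SpherePacking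

end Tetrahedra

/-! ### From Euclidean realizations to polynomial inequalities -/

section Realization

variable {V : Type*}

/-- `areaSq` and `volSq` are 4 and 16 times Gram determinants of edge vectors at `i`, which are
linearly independent. -/
theorem isNondegenerateOn_of_affineIndependent {E : Type*} [NormedAddCommGroup E]
    [InnerProductSpace ℝ E] {d : V → V → ℝ} {X : Finset V} (p : X → E) (hp : AffineIndependent ℝ p)
    (hd : ∀ i j : X, i ≠ j → dist (p i) (p j) = len d i j) : IsNondegenerateOn d X := by
  have hs : ∀ i j : X, i ≠ j → sqLen d i j = ‖p i - p j‖ ^ 2 := fun i j hij => by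
    unfold sqLen; rw [← hd i j hij, dist_eq_norm]
  have hg : ∀ i j k : X, i ≠ j → i ≠ k → j ≠ k → sqLen d i j + sqLen d i k - sqLen d j k =
      2 * inner ℝ (p j - p i) (p k - p i) := fun i j k hij hik hjk => by
    have e : p j - p k = (p j - p i) - (p k - p i) := by abel
    rw [hs i j hij, hs i k hik, hs j k hjk, e, norm_sub_sq_real (p j - p i), norm_sub_rev (p i),
      norm_sub_rev (p i)]
    ring
  have hs' : ∀ i j : X, i ≠ j → sqLen d i j = inner ℝ (p j - p i) (p j - p i) :=
    fun i j hij => by rw [hs i j hij, norm_sub_rev, real_inner_self_eq_norm_sq]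
  have hl : ∀ i : X, LinearIndependent ℝ fun j : {x // x ≠ i} => p j - p i := fun i =>
    (affineIndependent_iff_linearIndependent_vsub ℝ p i).1 hp
  refine ⟨fun i hi j hj hij => ?_, fun i hi j hj k hk hij hik hjk => ?_,
    fun i hi j hj k hk l hl' hij hik hil hjk hjl hkl => ?_⟩
  · have h : (⟨i, hi⟩ : X) ≠ ⟨j, hj⟩ := by simpa using hij
    exact hd _ _ h ▸ dist_pos.2 (hp.injective.ne h)
  · lift i to X using hi
    lift j to X using hj
    lift k to X using hk
    rw [ne_eq, Subtype.coe_inj] at hij hik hjk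
    have hinj : Function.Injective
        (![⟨j, Ne.symm hij⟩, ⟨k, Ne.symm hik⟩] : Fin 2 → {x // x ≠ i}) := by
      intro a b
      fin_cases a <;> fin_cases b <;> simp [hjk, eq_comm]
    have := (Matrix.posDef_gram_of_linearIndependent ((hl i).comp _ hinj)).det_pos
    rw [Matrix.det_fin_two] at this
    simp only [Matrix.gram_apply, Function.comp, Matrix.cons_val_zero, Matrix.cons_val_one] at this
    unfold areaSq
    rw [hg i j k hij hik hjk, hs' i j hij, hs' i k hik]
    rw [real_inner_comm (p j - p i) (p k - p i)] at this
    linarith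
  · lift i to X using hi
    lift j to X using hj
    lift k to X using hk
    lift l to X using hl'
    rw [ne_eq, Subtype.coe_inj] at hij hik hil hjk hjl hkl
    have hinj : Function.Injective
        (![⟨j, Ne.symm hij⟩, ⟨k, Ne.symm hik⟩, ⟨l, Ne.symm hil⟩] : Fin 3 → {x // x ≠ i}) := by
      intro a b
      fin_cases a <;> fin_cases b <;>
        simp [hjk, hjl, hkl, Ne.symm hjk, Ne.symm hjl, Ne.symm hkl]
    have := (Matrix.posDef_gram_of_linearIndependent ((hl i).comp _ hinj)).det_pos
    rw [Matrix.det_fin_three] at this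
    simp only [Matrix.gram_apply, Function.comp, Matrix.cons_val_zero, Matrix.cons_val_one,
      Matrix.cons_val_two, Matrix.tail_cons, Matrix.head_cons] at this
    unfold volSq
    rw [hg i j k hij hik hjk, hg i j l hij hil hjl, hg i k l hik hil hkl, hs' i j hij, hs' i k hik,
      hs' i l hil]
    rw [real_inner_comm (p j - p i) (p k - p i), real_inner_comm (p j - p i) (p l - p i),
      real_inner_comm (p k - p i) (p l - p i)] at this
    linarith

end Realization

/-! ### Regular metrics and sums over tetrahedra -/

section Complex

variable {V : Type*} [DecidableEq V] {K : AbstractSimplicialComplex V} {i j k l : V}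

theorem isTetrahedron_ne (h : IsTetrahedron K i j k l) :
    i ≠ j ∧ i ≠ k ∧ i ≠ l ∧ j ≠ k ∧ j ≠ l ∧ k ≠ l := by
  have h := h.1
  rw [Finset.card_insert_eq_ite, Finset.card_insert_eq_ite, Finset.card_insert_eq_ite,
    Finset.card_singleton] at h
  split_ifs at h <;> simp_all

theorem isEdge_comm : IsEdge K i j ↔ IsEdge K j i := by
  unfold IsEdge
  rw [Finset.pair_comm, ne_comm]

theorem isTetrahedron_swap₁ : IsTetrahedron K i j k l ↔ IsTetrahedron K j i k l := by
  unfold IsTetrahedron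
  rw [Finset.insert_comm]

theorem isTetrahedron_swap₂ : IsTetrahedron K i j k l ↔ IsTetrahedron K i k j l := by
  unfold IsTetrahedron
  rw [Finset.insert_comm j k]

theorem isTetrahedron_swap₃ : IsTetrahedron K i j k l ↔ IsTetrahedron K i j l k := by
  unfold IsTetrahedron
  rw [Finset.pair_comm]

theorem IsTetrahedron.isEdge (h : IsTetrahedron K i j k l) : IsEdge K i j :=
  ⟨(isTetrahedron_ne h).1, (K.isRelLowerSet_faces h.2).2 (by grind) (by simp)⟩

/-- `d` is nondegenerate on all tetrahedra and satisfies the compatibility condition. -/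
structure IsRegular (K : AbstractSimplicialComplex V) (d : V → V → ℝ) : Prop where
  nondegenerate : ∀ i j k l, IsTetrahedron K i j k l → IsNondegenerateOn d {i, j, k, l}
  compat : ∀ i j k, IsTriangle K i j k →
    d i j ^ 2 + d j k ^ 2 + d k i ^ 2 = d j i ^ 2 + d i k ^ 2 + d k j ^ 2
  len_pos : ∀ i j, IsEdge K i j → 0 < len d i j

theorem IsMetric.isRegular {d : V → V → ℝ} (h : IsMetric K d) : IsRegular K d where
  nondegenerate i j k l hT := by
    obtain ⟨p, hp, hd⟩ := h.1 _ hT.2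
    exact isNondegenerateOn_of_affineIndependent p hp hd
  compat := h.2
  len_pos i j hE := by
    obtain ⟨p, hp, hd⟩ := h.1 _ hE.2
    exact (isNondegenerateOn_of_affineIndependent p hp hd).len_pos i (by simp) j (by simp) hE.1

theorem IsRegular.compat_on {d : V → V → ℝ} (h : IsRegular K d) (hT : IsTetrahedron K i j k l) :
    ∀ a ∈ ({i, j, k, l} : Finset V), ∀ b ∈ ({i, j, k, l} : Finset V),
      ∀ e ∈ ({i, j, k, l} : Finset V), a ≠ b → a ≠ e → b ≠ e →
      d a b ^ 2 + d b e ^ 2 + d e a ^ 2 = d b a ^ 2 + d a e ^ 2 + d e b ^ 2 :=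
  fun a ha b hb e he hab hae hbe => h.compat a b e
    ⟨Finset.card_eq_three.2 ⟨a, b, e, hab, hae, hbe, rfl⟩,
      (K.isRelLowerSet_faces hT.2).2 (Finset.insert_subset ha (Finset.insert_subset hb
        (Finset.singleton_subset_iff.2 he))) (by simp)⟩

section Sums

variable [Fintype V]

open Classical in
/-- The sum of `F` over all tetrahedra of `K`, with ordered vertices. -/
noncomputable def tetSum (K : AbstractSimplicialComplex V) (F : V → V → V → V → ℝ) : ℝ :=
  ∑ i, ∑ j, ∑ k, ∑ l, if IsTetrahedron K i j k l then F i j k l else 0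

open Classical in
theorem tetSum_swap₁ (K : AbstractSimplicialComplex V) (F : V → V → V → V → ℝ) :
    tetSum K (fun i j k l => F j i k l) = tetSum K F := by
  unfold tetSum
  rw [Finset.sum_comm]
  exact Finset.sum_congr rfl fun i _ => Finset.sum_congr rfl fun j _ =>
    Finset.sum_congr rfl fun k _ => Finset.sum_congr rfl fun l _ =>
    if_congr isTetrahedron_swap₁ rfl rfl

open Classical in
theorem tetSum_swap₂ (K : AbstractSimplicialComplex V) (F : V → V → V → V → ℝ) :
    tetSum K (fun i j k l => F i k j l) = tetSum K F := by
  unfold tetSum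
  refine Finset.sum_congr rfl fun i _ => ?_
  rw [Finset.sum_comm]
  exact Finset.sum_congr rfl fun j _ =>
    Finset.sum_congr rfl fun k _ => Finset.sum_congr rfl fun l _ =>
    if_congr isTetrahedron_swap₂ rfl rfl

open Classical in
theorem tetSum_swap₃ (K : AbstractSimplicialComplex V) (F : V → V → V → V → ℝ) :
    tetSum K (fun i j k l => F i j l k) = tetSum K F := by
  unfold tetSum
  refine Finset.sum_congr rfl fun i _ => Finset.sum_congr rfl fun j _ => ?_
  rw [Finset.sum_comm]
  exact Finset.sum_congr rfl fun k _ => Finset.sum_congr rfl fun l _ =>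
    if_congr isTetrahedron_swap₃ rfl rfl

theorem tetSum_add (K : AbstractSimplicialComplex V) (F G : V → V → V → V → ℝ) :
    tetSum K (fun i j k l => F i j k l + G i j k l) = tetSum K F + tetSum K G := by
  unfold tetSum
  simp only [← Finset.sum_add_distrib]
  refine Finset.sum_congr rfl fun i _ => Finset.sum_congr rfl fun j _ =>
    Finset.sum_congr rfl fun k _ => Finset.sum_congr rfl fun l _ => ?_
  split_ifs <;> simp

theorem tetSum_congr {F G : V → V → V → V → ℝ}
    (h : ∀ i j k l, IsTetrahedron K i j k l → F i j k l = G i j k l) :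
    tetSum K F = tetSum K G := by
  unfold tetSum
  refine Finset.sum_congr rfl fun i _ => Finset.sum_congr rfl fun j _ =>
    Finset.sum_congr rfl fun k _ => Finset.sum_congr rfl fun l _ => ?_
  split_ifs with hT
  · exact h i j k l hT
  · rfl

/-- Reindexing the ordered vertices moves any edge to `{i, j}`. This transfers identities for single
tetrahedra to sums organized by edges. -/
theorem tetSum_edgeSum (K : AbstractSimplicialComplex V) (F : V → V → V → V → ℝ) :
    tetSum K (edgeSum F) = 6 * tetSum K F := by
  have e₁ : tetSum K (fun i j k l => F i k j l) = tetSum K F := tetSum_swap₂ K F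
  have e₂ : tetSum K (fun i j k l => F i l j k) = tetSum K F := by
    rw [← e₁, ← tetSum_swap₃ K (fun i j k l => F i k j l)]
  have e₃ : tetSum K (fun i j k l => F j k i l) = tetSum K F := by
    rw [← e₁, ← tetSum_swap₁ K (fun i j k l => F i k j l)]
  have e₄ : tetSum K (fun i j k l => F j l i k) = tetSum K F := by
    rw [← e₂, ← tetSum_swap₁ K (fun i j k l => F i l j k)]
  have e₅ : tetSum K (fun i j k l => F k l i j) = tetSum K F := by
    rw [← e₄, ← tetSum_swap₂ K (fun i j k l => F j l i k)]
  unfold edgeSum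
  rw [tetSum_add, tetSum_add, tetSum_add, tetSum_add, tetSum_add, e₁, e₂, e₃, e₄, e₅]
  ring

end Sums

end Complex

/-! ### Derivatives along a conformal structure -/

section Variation

variable {V : Type*} [Fintype V] [DecidableEq V]

/-- A conformal structure all of whose values are regular. In contrast to
`IsConformalStructure`, the values need not be metrics. -/
structure IsRegularConformal (K : AbstractSimplicialComplex V) (U : Set (V → ℝ))
    (C : (V → ℝ) → V → V → ℝ) : Prop where
  isOpen : IsOpen U
  smooth : ∀ i j, IsEdge K i j → ContDiffOn ℝ ∞ (fun f => C f i j) U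
  regular : ∀ f ∈ U, IsRegular K (C f)
  partialDeriv_len : ∀ i j, IsEdge K i j → ∀ f ∈ U,
    partialDeriv (fun g => len (C g) i j) i f = C f i j
  partialDeriv_eq_zero : ∀ i j, IsEdge K i j → ∀ k, k ≠ i → k ≠ j → ∀ f ∈ U,
    partialDeriv (fun g => C g i j) k f = 0

theorem IsConformalStructure.isRegularConformal {K : AbstractSimplicialComplex V}
    {U : Set (V → ℝ)} {C : (V → ℝ) → V → V → ℝ} (h : IsConformalStructure K U C) :
    IsRegularConformal K U C where
  isOpen := h.isOpen
  smooth := h.smooth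
  regular f hf := (h.isMetric f hf).isRegular
  partialDeriv_len := h.partialDeriv_len
  partialDeriv_eq_zero := h.partialDeriv_eq_zero

theorem fderiv_apply_eq_sum_partialDeriv (F : (V → ℝ) → ℝ) (f v : V → ℝ) :
    fderiv ℝ F f v = ∑ i, v i * partialDeriv F i f := by
  conv_lhs => rw [pi_eq_sum_univ' v, map_sum]
  exact Finset.sum_congr rfl fun i _ => by rw [map_smul, smul_eq_mul]; rfl

omit [DecidableEq V] in
theorem hasDerivAt_comp_line {F : (V → ℝ) → ℝ} {f v : V → ℝ} {t : ℝ}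
    (hF : DifferentiableAt ℝ F (f + t • v)) :
    HasDerivAt (fun t : ℝ => F (f + t • v)) (fderiv ℝ F (f + t • v) v) t := by
  have h : HasDerivAt (fun t : ℝ => f + t • v) v t := by
    simpa using ((hasDerivAt_id t).smul_const v).const_add f
  exact hF.hasFDerivAt.comp_hasDerivAt t h

theorem partialDeriv_add {F G : (V → ℝ) → ℝ} {f : V → ℝ} (hF : DifferentiableAt ℝ F f)
    (hG : DifferentiableAt ℝ G f) (k : V) :
    partialDeriv (fun g => F g + G g) k f = partialDeriv F k f + partialDeriv G k f := by
  unfold partialDeriv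
  rw [fderiv_fun_add hF hG]
  rfl

theorem partialDeriv_comm {F : (V → ℝ) → ℝ} {f : V → ℝ} (hF : ContDiffAt ℝ ∞ F f) (i j : V) :
    partialDeriv (partialDeriv F i) j f = partialDeriv (partialDeriv F j) i f := by
  have hd : DifferentiableAt ℝ (fderiv ℝ F) f :=
    (hF.fderiv_right (m := 1) (by norm_cast)).differentiableAt one_ne_zero
  have h : ∀ i j, partialDeriv (partialDeriv F i) j f =
      fderiv ℝ (fderiv ℝ F) f (Pi.single j 1) (Pi.single i 1) := fun i j => by
    unfold partialDeriv
    rw [fderiv_clm_apply hd (differentiableAt_const _)]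
    simp
  rw [h, h]
  have h2 : minSmoothness ℝ 2 ≤ ∞ := by
    rw [minSmoothness_of_isRCLikeNormedField]
    exact WithTop.coe_le_coe.2 (le_top : (2 : ℕ∞) ≤ ⊤)
  exact (hF.isSymmSndFDerivAt h2).eq _ _

namespace IsRegularConformal

variable {K : AbstractSimplicialComplex V} {U : Set (V → ℝ)} {C : (V → ℝ) → V → V → ℝ}
  {f v : V → ℝ} {i j k l : V}

theorem contDiffAt (h : IsRegularConformal K U C) (hf : f ∈ U) (hE : IsEdge K i j) :
    ContDiffAt ℝ ∞ (fun g => C g i j) f :=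
  (h.smooth i j hE).contDiffAt (h.isOpen.mem_nhds hf)

theorem contDiffAt_len (h : IsRegularConformal K U C) (hf : f ∈ U) (hE : IsEdge K i j) :
    ContDiffAt ℝ ∞ (fun g => len (C g) i j) f :=
  (h.contDiffAt hf hE).add (h.contDiffAt hf (isEdge_comm.1 hE))

theorem differentiableAt (h : IsRegularConformal K U C) (hf : f ∈ U) (hE : IsEdge K i j) :
    DifferentiableAt ℝ (fun g => C g i j) f :=
  (h.contDiffAt hf hE).differentiableAt (by simp)

/-- Near `f`, `d_ij` is the partial derivative of `ℓ_ij` along `f_i`, so `q_ij` is a mixed second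
derivative of the symmetric function `ℓ_ij`. -/
theorem qCoeff_comm (h : IsRegularConformal K U C) (hf : f ∈ U) (hE : IsEdge K i j) :
    qCoeff C f i j = qCoeff C f j i := by
  have e : ∀ i j, IsEdge K i j →
      qCoeff C f i j = partialDeriv (partialDeriv (fun g => len (C g) i j) i) j f := by
    intro i j hE
    have : (fun g => C g i j) =ᶠ[nhds f] partialDeriv (fun g => len (C g) i j) i := by
      filter_upwards [h.isOpen.mem_nhds hf] with g hg
      exact (h.partialDeriv_len i j hE g hg).symm
    unfold qCoeff
    unfold partialDeriv at this ⊢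
    rw [this.fderiv_eq]
  rw [e i j hE, e j i (isEdge_comm.1 hE), partialDeriv_comm (h.contDiffAt_len hf hE)]
  simp only [len_comm _ i j]

/-- Subtract `∂d_ji/∂f_i = q_ji = q_ij` from `∂ℓ_ij/∂f_i = d_ij`. -/
theorem partialDeriv_self (h : IsRegularConformal K U C) (hf : f ∈ U) (hE : IsEdge K i j) :
    partialDeriv (fun g => C g i j) i f = C f i j - qCoeff C f i j := by
  rw [h.qCoeff_comm hf hE, ← h.partialDeriv_len i j hE f hf]
  unfold len qCoeff
  rw [partialDeriv_add (h.differentiableAt hf hE) (h.differentiableAt hf (isEdge_comm.1 hE))]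
  ring

theorem fderiv_apply (h : IsRegularConformal K U C) (hf : f ∈ U) (hE : IsEdge K i j) :
    fderiv ℝ (fun g => C g i j) f v =
      (C f i j - qCoeff C f i j) * v i + qCoeff C f i j * v j := by
  rw [fderiv_apply_eq_sum_partialDeriv, Finset.sum_eq_add i j hE.1 ?_ (by simp) (by simp),
    h.partialDeriv_self hf hE]
  · unfold qCoeff
    ring
  · intro m _ hm
    rw [h.partialDeriv_eq_zero i j hE m hm.1 hm.2 f hf, mul_zero]

theorem hasDerivAt (h : IsRegularConformal K U C) {t : ℝ} (hf : f + t • v ∈ U)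
    (hE : IsEdge K i j) : HasDerivAt (fun t : ℝ => C (f + t • v) i j)
      ((C (f + t • v) i j - qCoeff C (f + t • v) i j) * v i + qCoeff C (f + t • v) i j * v j) t := by
  rw [← h.fderiv_apply hf hE]
  exact hasDerivAt_comp_line (h.differentiableAt hf hE)

theorem hasDerivAt_len (h : IsRegularConformal K U C) {t : ℝ} (hf : f + t • v ∈ U)
    (hE : IsEdge K i j) : HasDerivAt (fun t : ℝ => len (C (f + t • v)) i j)
      (C (f + t • v) i j * v i + C (f + t • v) j i * v j) t := by
  refine ((h.hasDerivAt hf hE).add (h.hasDerivAt hf (isEdge_comm.1 hE))).congr_deriv ?_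
  rw [h.qCoeff_comm hf hE]
  ring

theorem hasDerivAt_dihedral (h : IsRegularConformal K U C) {t : ℝ} (hf : f + t • v ∈ U)
    (hT : IsTetrahedron K i j k l) : HasDerivAt (fun t : ℝ => dihedral (C (f + t • v)) i j k l)
      (dihedralRate (C (f + t • v)) v i j k l) t := by
  obtain ⟨hij, hik, hil, hjk, hjl, hkl⟩ := isTetrahedron_ne hT
  refine PiecewiseFlat.hasDerivAt_dihedral ((h.regular _ hf).nondegenerate i j k l hT)
    (w := fun a b => C (f + t • v) a b * v a + C (f + t • v) b a * v b) ?_ ?_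
    (by simp) (by simp) (by simp) (by simp) hij hik hil hjk hjl hkl
  · intro a ha b hb hab
    exact h.hasDerivAt_len hf ⟨hab, (K.isRelLowerSet_faces hT.2).2
      (Finset.insert_subset ha (Finset.singleton_subset_iff.2 hb)) (by simp)⟩
  · intro a _ b _ _
    unfold splitting
    rw [len_comm _ b a]
    ring

open Classical in
theorem hasDerivAt_deficit (h : IsRegularConformal K U C) {t : ℝ} (hf : f + t • v ∈ U) (i j : V) :
    HasDerivAt (fun t : ℝ => deficit K (C (f + t • v)) i j)
      (-((1 / 2) * ∑ k, ∑ l, if IsTetrahedron K i j k l then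
        dihedralRate (C (f + t • v)) v i j k l else 0)) t := by
  unfold deficit
  refine HasDerivAt.const_sub _ (HasDerivAt.const_mul _ (HasDerivAt.fun_sum fun k _ =>
    HasDerivAt.fun_sum fun l _ => ?_))
  split_ifs with hT
  · exact h.hasDerivAt_dihedral hf hT
  · exact hasDerivAt_const _ _

theorem contDiffAt_EHR (h : IsRegularConformal K U C) (hf : f ∈ U) :
    ContDiffAt ℝ ∞ (fun g => EHR K (C g)) f := by
  unfold EHR edgeCurvature deficit
  refine contDiffAt_const.mul (ContDiffAt.sum fun i _ => ContDiffAt.sum fun j _ => ?_)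
  split_ifs with hE
  · refine ContDiffAt.mul (contDiffAt_const.sub (contDiffAt_const.mul
      (ContDiffAt.sum fun k _ => ContDiffAt.sum fun l _ => ?_))) (h.contDiffAt_len hf hE)
    split_ifs with hT
    · obtain ⟨hij, hik, hil, hjk, hjl, hkl⟩ := isTetrahedron_ne hT
      exact contDiffAt_dihedral ((h.regular _ hf).nondegenerate i j k l hT)
        (fun a ha b hb hab => h.contDiffAt_len hf ⟨hab, (K.isRelLowerSet_faces hT.2).2
          (Finset.insert_subset ha (Finset.singleton_subset_iff.2 hb)) (by simp)⟩)
        (by simp) (by simp) (by simp) (by simp) hij hik hil hjk hjl hkl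
    · exact contDiffAt_const
  · exact contDiffAt_const

end IsRegularConformal

open Classical in
theorem sum_edge_mul_sum_tetrahedron (K : AbstractSimplicialComplex V)
    (R : V → V → V → V → ℝ) (W : V → V → ℝ) :
    (∑ i, ∑ j, if IsEdge K i j then
      (∑ k, ∑ l, if IsTetrahedron K i j k l then R i j k l else 0) * W i j else 0) =
      tetSum K fun i j k l => R i j k l * W i j := by
  unfold tetSum
  refine Finset.sum_congr rfl fun i _ => Finset.sum_congr rfl fun j _ => ?_
  split_ifs with hE
  · simp only [Finset.sum_mul, ite_mul, zero_mul]
  · refine (Finset.sum_eq_zero fun k _ => Finset.sum_eq_zero fun l _ => ?_).symm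
    exact if_neg fun hT => hE hT.isEdge

theorem IsRegular.tetSum_dihedralRate_mul_len {K : AbstractSimplicialComplex V}
    {d : V → V → ℝ} (h : IsRegular K d) (v : V → ℝ) :
    tetSum K (fun i j k l => dihedralRate d v i j k l * len d i j) = 0 := by
  have e : tetSum K (edgeSum fun i j k l => dihedralRate d v i j k l * len d i j) =
      tetSum K fun _ _ _ _ => 0 := tetSum_congr fun i j k l hT => by
    obtain ⟨hij, hik, hil, hjk, hjl, hkl⟩ := isTetrahedron_ne hT
    exact edgeSum_dihedralRate_mul_len (h.nondegenerate i j k l hT) v (by simp) (by simp) (by simp)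
      (by simp) hij hik hil hjk hjl hkl
  have e₀ : tetSum K (fun _ _ _ _ => (0 : ℝ)) = 0 := by simp [tetSum]
  rw [tetSum_edgeSum, e₀] at e
  linarith

theorem IsRegular.tetSum_dihedralRate_mul {K : AbstractSimplicialComplex V}
    {d : V → V → ℝ} (h : IsRegular K d) (v : V → ℝ) :
    tetSum K (fun i j k l => dihedralRate d v i j k l * (d i j * v i + d j i * v j)) =
      tetSum K (fun i j k l => -(2 * (dualArea d i j k l / len d i j) * (v i - v j) ^ 2)) := by
  have e : tetSum K (edgeSum fun i j k l =>
      dihedralRate d v i j k l * (d i j * v i + d j i * v j)) =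
      tetSum K (edgeSum fun i j k l => -(2 * (dualArea d i j k l / len d i j) * (v i - v j) ^ 2)) :=
    tetSum_congr fun i j k l hT => by
      obtain ⟨hij, hik, hil, hjk, hjl, hkl⟩ := isTetrahedron_ne hT
      exact edgeSum_dihedralRate_mul (h.nondegenerate i j k l hT) (h.compat_on hT) v (by simp)
        (by simp) (by simp) (by simp) hij hik hil hjk hjl hkl
  rw [tetSum_edgeSum, tetSum_edgeSum] at e
  linarith

theorem IsRegular.deficit_comm {K : AbstractSimplicialComplex V}
    {d : V → V → ℝ} (h : IsRegular K d) (i j : V) : deficit K d i j = deficit K d j i := by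
  classical
  unfold deficit
  congr 2
  refine Finset.sum_congr rfl fun k _ => Finset.sum_congr rfl fun l _ => ?_
  by_cases hT : IsTetrahedron K i j k l
  · obtain ⟨hij, hik, hil, hjk, hjl, hkl⟩ := isTetrahedron_ne hT
    rw [if_pos hT, if_pos (isTetrahedron_swap₁.1 hT), dihedral_swap₁
      (h.nondegenerate i j k l hT) (by simp) (by simp) (by simp) (by simp) hij hik hil hjk hjl hkl]
  · rw [if_neg hT, if_neg fun h => hT (isTetrahedron_swap₁.1 h)]

end Variation

/-! ### First and second variation of the functional -/

section SecondVariation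

variable {V : Type*} [Fintype V] [DecidableEq V] {K : AbstractSimplicialComplex V}
  {U : Set (V → ℝ)} {C : (V → ℝ) → V → V → ℝ} {f v : V → ℝ}

open Classical in
/-- The derivative of `EHR K d` in the conformal direction `v`. -/
noncomputable def conformalVariation (K : AbstractSimplicialComplex V) (d : V → V → ℝ)
    (v : V → ℝ) : ℝ :=
  (1 / 2) * ∑ i, ∑ j, if IsEdge K i j then deficit K d i j * (d i j * v i + d j i * v j) else 0

open Classical in
/-- The part of the second variation of `EHR` that comes from the variation of `f` along edges. -/
noncomputable def edgeForm (K : AbstractSimplicialComplex V) (d q : V → V → ℝ) (v : V → ℝ) : ℝ :=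
  ∑ i, ∑ j, if IsEdge K i j then
    (dualLen K d i j - (1 / 2) * q i j * edgeCurvature K d i j) / len d i j * (v i - v j) ^ 2 else 0

/-- Of the two terms of the product rule, the one with the derivatives of the angles vanishes by
Schläfli's formula. -/
theorem IsRegularConformal.hasDerivAt_EHR (h : IsRegularConformal K U C) {t : ℝ}
    (hf : f + t • v ∈ U) : HasDerivAt (fun t : ℝ => EHR K (C (f + t • v)))
      (conformalVariation K (C (f + t • v)) v) t := by
  classical
  have key : HasDerivAt (fun t : ℝ => EHR K (C (f + t • v))) ((1 / 2) * ∑ i, ∑ j,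
      if IsEdge K i j then -((1 / 2) * ∑ k, ∑ l, if IsTetrahedron K i j k l then
        dihedralRate (C (f + t • v)) v i j k l else 0) * len (C (f + t • v)) i j +
        deficit K (C (f + t • v)) i j * (C (f + t • v) i j * v i + C (f + t • v) j i * v j)
      else 0) t := by
    unfold EHR edgeCurvature
    refine HasDerivAt.const_mul _ (HasDerivAt.fun_sum fun i _ => HasDerivAt.fun_sum fun j _ => ?_)
    split_ifs with hE
    · exact (h.hasDerivAt_deficit hf i j).fun_mul (h.hasDerivAt_len hf hE)
    · exact hasDerivAt_const _ _
  refine key.congr_deriv ?_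
  have e := (h.regular _ hf).tetSum_dihedralRate_mul_len v
  rw [← sum_edge_mul_sum_tetrahedron] at e
  -- The factor `1 / 4` arises because each edge and each opposite pair `k, l` is counted in both
  -- orders.
  have e' : ((1 / 2) * ∑ i, ∑ j,
      if IsEdge K i j then -((1 / 2) * ∑ k, ∑ l, if IsTetrahedron K i j k l then
        dihedralRate (C (f + t • v)) v i j k l else 0) * len (C (f + t • v)) i j +
        deficit K (C (f + t • v)) i j * (C (f + t • v) i j * v i + C (f + t • v) j i * v j)
      else 0) = -(1 / 4) * (∑ i, ∑ j, if IsEdge K i j then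
        (∑ k, ∑ l, if IsTetrahedron K i j k l then
          dihedralRate (C (f + t • v)) v i j k l else 0) * len (C (f + t • v)) i j else 0) +
      conformalVariation K (C (f + t • v)) v := by
    unfold conformalVariation
    simp only [Finset.mul_sum, ← Finset.sum_add_distrib]
    refine Finset.sum_congr rfl fun i _ => Finset.sum_congr rfl fun j _ => ?_
    split_ifs with hE
    · simp only [← Finset.mul_sum]
      ring
    · ring
  rw [e', e]
  ring

/-- The derivatives of the angles give the dual lengths by the tetrahedron identity; those of `d`
give `d_ij v_i² + d_ji v_j² - q_ij (v_i - v_j)²` on each edge. -/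
theorem IsRegularConformal.hasDerivAt_conformalVariation (h : IsRegularConformal K U C)
    {t : ℝ} (hf : f + t • v ∈ U) :
    HasDerivAt (fun t : ℝ => conformalVariation K (C (f + t • v)) v)
      (∑ i, scalarCurvature K (C (f + t • v)) i * v i ^ 2 +
        edgeForm K (C (f + t • v)) (qCoeff C (f + t • v)) v) t := by
  classical
  set g := f + t • v with hg
  have key : HasDerivAt (fun t : ℝ => conformalVariation K (C (f + t • v)) v) ((1 / 2) * ∑ i, ∑ j,
      if IsEdge K i j then -((1 / 2) * ∑ k, ∑ l, if IsTetrahedron K i j k l then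
        dihedralRate (C g) v i j k l else 0) * (C g i j * v i + C g j i * v j) +
        deficit K (C g) i j * (((C g i j - qCoeff C g i j) * v i + qCoeff C g i j * v j) * v i +
          ((C g j i - qCoeff C g j i) * v j + qCoeff C g j i * v i) * v j)
      else 0) t := by
    unfold conformalVariation
    refine HasDerivAt.const_mul _ (HasDerivAt.fun_sum fun i _ => HasDerivAt.fun_sum fun j _ => ?_)
    split_ifs with hE
    · exact (h.hasDerivAt_deficit hf i j).fun_mul (((h.hasDerivAt hf hE).mul_const _).fun_add
        ((h.hasDerivAt hf (isEdge_comm.1 hE)).mul_const _))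
    · exact hasDerivAt_const _ _
  refine key.congr_deriv ?_
  have hr := h.regular g hf
  have e₁ := hr.tetSum_dihedralRate_mul v
  have e₂ : tetSum K (fun i j k l =>
      -(2 * (dualArea (C g) i j k l / len (C g) i j) * (v i - v j) ^ 2)) =
      tetSum K fun i j k l => dualArea (C g) i j k l *
        (-(2 / len (C g) i j * (v i - v j) ^ 2)) := tetSum_congr fun i j k l _ => by ring
  rw [e₂, ← sum_edge_mul_sum_tetrahedron, ← sum_edge_mul_sum_tetrahedron] at e₁
  have e₃ : (∑ i, ∑ j, if IsEdge K i j then deficit K (C g) i j * C g j i * v j ^ 2 else 0) =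
      ∑ i, ∑ j, if IsEdge K i j then deficit K (C g) i j * C g i j * v i ^ 2 else 0 := by
    rw [Finset.sum_comm]
    refine Finset.sum_congr rfl fun i _ => Finset.sum_congr rfl fun j _ => ?_
    rw [hr.deficit_comm j i]
    by_cases hE : IsEdge K i j
    · rw [if_pos hE, if_pos (isEdge_comm.1 hE)]
    · rw [if_neg hE, if_neg fun h => hE (isEdge_comm.1 h)]
  have e₄ : ∑ i, scalarCurvature K (C g) i * v i ^ 2 =
      ∑ i, ∑ j, if IsEdge K i j then deficit K (C g) i j * C g i j * v i ^ 2 else 0 := by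
    unfold scalarCurvature
    simp only [Finset.sum_mul, ite_mul, zero_mul]
  have e₅ : ((1 / 2) * ∑ i, ∑ j, if IsEdge K i j then
      -((1 / 2) * ∑ k, ∑ l, if IsTetrahedron K i j k l then
        dihedralRate (C g) v i j k l else 0) * (C g i j * v i + C g j i * v j) +
        deficit K (C g) i j * (((C g i j - qCoeff C g i j) * v i + qCoeff C g i j * v j) * v i +
          ((C g j i - qCoeff C g j i) * v j + qCoeff C g j i * v i) * v j)
      else 0) = -(1 / 4) * (∑ i, ∑ j, if IsEdge K i j then
        (∑ k, ∑ l, if IsTetrahedron K i j k l then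
        dihedralRate (C g) v i j k l else 0) * (C g i j * v i + C g j i * v j) else 0) +
      (1 / 2) * (∑ i, ∑ j, if IsEdge K i j then deficit K (C g) i j * C g j i * v j ^ 2 else 0) +
      (1 / 2) * (∑ i, ∑ j, if IsEdge K i j then deficit K (C g) i j * C g i j * v i ^ 2 else 0) -
      (1 / 2) * (∑ i, ∑ j, if IsEdge K i j then
        deficit K (C g) i j * qCoeff C g i j * (v i - v j) ^ 2 else 0) := by
    simp only [Finset.mul_sum, ← Finset.sum_add_distrib, ← Finset.sum_sub_distrib]
    refine Finset.sum_congr rfl fun i _ => Finset.sum_congr rfl fun j _ => ?_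
    split_ifs with hE
    · rw [h.qCoeff_comm hf (isEdge_comm.1 hE)]
      simp only [← Finset.mul_sum]
      ring
    · ring
  have e₆ : edgeForm K (C g) (qCoeff C g) v = -(1 / 4) * (∑ i, ∑ j, if IsEdge K i j then
        (∑ k, ∑ l, if IsTetrahedron K i j k l then dualArea (C g) i j k l else 0) *
          (-(2 / len (C g) i j * (v i - v j) ^ 2)) else 0) -
      (1 / 2) * (∑ i, ∑ j, if IsEdge K i j then
        deficit K (C g) i j * qCoeff C g i j * (v i - v j) ^ 2 else 0) := by
    unfold edgeForm dualLen edgeCurvature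
    simp only [Finset.mul_sum, ← Finset.sum_sub_distrib]
    refine Finset.sum_congr rfl fun i _ => Finset.sum_congr rfl fun j _ => ?_
    split_ifs with hE
    · have := hr.len_pos i j hE
      simp only [← Finset.mul_sum]
      field_simp
      ring
    · ring
  rw [e₅, e₃, e₁, e₄, e₆]
  ring

theorem IsRegularConformal.iteratedDeriv_two_EHR (h : IsRegularConformal K U C) (hf : f ∈ U)
    (v : V → ℝ) : iteratedDeriv 2 (fun t : ℝ => EHR K (C (f + t • v))) 0 =
      ∑ i, scalarCurvature K (C f) i * v i ^ 2 + edgeForm K (C f) (qCoeff C f) v := by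
  have h0 : f + (0 : ℝ) • v = f := by simp
  have hc : Continuous fun t : ℝ => f + t • v := by fun_prop
  have hU : ∀ᶠ t : ℝ in nhds 0, f + t • v ∈ U :=
    hc.continuousAt.eventually_mem (by rw [h0]; exact h.isOpen.mem_nhds hf)
  have e : deriv (fun t : ℝ => EHR K (C (f + t • v))) =ᶠ[nhds 0]
      fun t => conformalVariation K (C (f + t • v)) v := by
    filter_upwards [hU] with t ht
    exact (h.hasDerivAt_EHR ht).deriv
  have hd := h.hasDerivAt_conformalVariation (f := f) (v := v) (t := 0) (by rwa [h0])
  rw [iteratedDeriv_succ, iteratedDeriv_one, e.deriv_eq, hd.deriv, h0]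

omit [DecidableEq V] in
/-- A function that is smooth near `S`, with nonnegative second variation at the points of `S`, is
convex on each convex subset of `S`. -/
theorem isConvexFunctionalOn_of_iteratedDeriv {F : (V → ℝ) → ℝ} {S : Set (V → ℝ)}
    (hF : ∀ f ∈ S, ContDiffAt ℝ ∞ F f)
    (h2 : ∀ f ∈ S, ∀ v : V → ℝ, 0 ≤ iteratedDeriv 2 (fun t : ℝ => F (f + t • v)) 0) :
    IsConvexFunctionalOn F S := by
  refine ⟨fun f hf => ⟨hF f hf, h2 f hf⟩, fun A hAS hA => ⟨hA, ?_⟩⟩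
  intro x hx y hy a b ha hb hab
  set φ : ℝ → ℝ := fun t => F (x + t • (y - x)) with hφ
  have hmem : ∀ t ∈ Set.Icc (0 : ℝ) 1, x + t • (y - x) ∈ S := fun t ht =>
    hAS (hA.add_smul_sub_mem hx hy ht)
  have hsm : ∀ t ∈ Set.Icc (0 : ℝ) 1, ContDiffAt ℝ ∞ φ t := fun t ht => by
    have hl : ContDiffAt ℝ ∞ (fun t : ℝ => x + t • (y - x)) t := by fun_prop
    exact ContDiffAt.comp (g := F) t (hF _ (hmem t ht)) hl
  have hconv : ConvexOn ℝ (Set.Icc (0 : ℝ) 1) φ := by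
    refine convexOn_of_deriv2_nonneg' (convex_Icc 0 1)
      (fun t ht => ((hsm t ht).differentiableAt (by simp)).differentiableWithinAt)
      (fun t ht => ?_) fun t ht => ?_
    · have hd : DifferentiableAt ℝ (fderiv ℝ φ) t :=
        ((hsm t ht).fderiv_right (m := 1) (by norm_cast)).differentiableAt one_ne_zero
      exact (hd.clm_apply (differentiableAt_const (1 : ℝ))).differentiableWithinAt
    · have e := h2 _ (hmem t ht) (y - x)
      -- The second derivative at `t` is the second variation at the point `x + t • (y - x)` of `S`.
      have e' : (fun τ : ℝ => F (x + t • (y - x) + τ • (y - x))) = fun τ => φ (t + τ) := by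
        funext τ
        simp only [hφ]
        rw [add_smul, add_assoc]
      rw [e', iteratedDeriv_comp_const_add] at e
      simpa only [add_zero, iteratedDeriv_eq_iterate] using e
  have := hconv.2 (Set.left_mem_Icc.2 zero_le_one) (Set.right_mem_Icc.2 zero_le_one) ha hb hab
  have e : x + b • (y - x) = a • x + b • y := by
    rw [← eq_sub_iff_add_eq] at hab
    rw [hab]
    module
  simpa [hφ, e] using this

end SecondVariation

/-! ### Signs of the edge forms and convexity -/

section Convexity

variable {V : Type*} [Fintype V] [DecidableEq V] {K : AbstractSimplicialComplex V}

theorem edgeForm_nonneg {d q : V → V → ℝ} (hd : IsRegular K d)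
    (h : ∀ i j, IsEdge K i j → 0 < dualLen K d i j - (1 / 2) * q i j * edgeCurvature K d i j)
    (v : V → ℝ) : 0 ≤ edgeForm K d q v := by
  unfold edgeForm
  refine Finset.sum_nonneg fun i _ => Finset.sum_nonneg fun j _ => ?_
  split_ifs with hE
  · have := h i j hE
    have := hd.len_pos i j hE
    positivity
  · exact le_rfl

/-- The edge form of a sphere packing is nonnegative, tetrahedron by tetrahedron. -/
theorem edgeForm_spherePacking_nonneg {f : V → ℝ} (hd : IsRegular K (spherePacking f))
    {q : V → V → ℝ} (hq : ∀ i j, IsEdge K i j → q i j = 0) (v : V → ℝ) :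
    0 ≤ edgeForm K (spherePacking f) q v := by
  classical
  have e₁ : edgeForm K (spherePacking f) q v = (1 / 2) * tetSum K fun i j k l =>
      dualArea (spherePacking f) i j k l * (1 / len (spherePacking f) i j * (v i - v j) ^ 2) := by
    rw [← sum_edge_mul_sum_tetrahedron]
    unfold edgeForm dualLen
    simp only [Finset.mul_sum]
    refine Finset.sum_congr rfl fun i _ => Finset.sum_congr rfl fun j _ => ?_
    split_ifs with hE
    · rw [hq i j hE]
      simp only [← Finset.mul_sum]
      ring
    · ring
  have e₂ := tetSum_edgeSum K fun i j k l => dualArea (spherePacking f) i j k l /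
    len (spherePacking f) i j * (v i - v j) ^ 2
  have e₃ : 0 ≤ tetSum K (edgeSum fun i j k l => dualArea (spherePacking f) i j k l /
      len (spherePacking f) i j * (v i - v j) ^ 2) := by
    unfold tetSum
    refine Finset.sum_nonneg fun i _ => Finset.sum_nonneg fun j _ =>
      Finset.sum_nonneg fun k _ => Finset.sum_nonneg fun l _ => ?_
    split_ifs with hT
    · obtain ⟨hij, hik, hil, hjk, hjl, hkl⟩ := isTetrahedron_ne hT
      exact edgeSum_dualArea_pack_nonneg (hd.nondegenerate i j k l hT) (r := fun i => Real.exp (f i))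
        (fun _ _ => rfl) (fun i => Real.exp_pos _) v (by simp) (by simp) (by simp) (by simp)
        hij hik hil hjk hjl hkl
    · exact le_rfl
  have e₄ : (tetSum K fun i j k l => dualArea (spherePacking f) i j k l *
      (1 / len (spherePacking f) i j * (v i - v j) ^ 2)) = tetSum K fun i j k l =>
      dualArea (spherePacking f) i j k l / len (spherePacking f) i j * (v i - v j) ^ 2 :=
    tetSum_congr fun i j k l _ => by ring
  rw [e₁, e₄]
  linarith

theorem partialDeriv_exp (i k : V) (f : V → ℝ) :
    partialDeriv (fun g => Real.exp (g i)) k f = if k = i then Real.exp (f i) else 0 := by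
  have h : HasFDerivAt (fun g : V → ℝ => Real.exp (g i))
      (Real.exp (f i) • (ContinuousLinearMap.proj (R := ℝ) (φ := fun _ : V => ℝ) i)) f :=
    (ContinuousLinearMap.proj (R := ℝ) (φ := fun _ : V => ℝ) i).hasFDerivAt.exp
  unfold partialDeriv
  rw [h.fderiv]
  simp [Pi.single_apply, eq_comm]

/-- Near a metric, the sphere packing conformal structure is regular. -/
theorem isRegularConformal_spherePacking (K : AbstractSimplicialComplex V) :
    IsRegularConformal K {f | IsRegular K (spherePacking f)} spherePacking where
  isOpen := by
    have hlen : ∀ (f : V → ℝ) i j, 0 < len (spherePacking f) i j := fun f i j => by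
      unfold len spherePacking; positivity
    have hc : ∀ i j, Continuous fun f : V → ℝ => sqLen (spherePacking f) i j := fun i j => by
      unfold sqLen len spherePacking; fun_prop
    -- Lengths and face areas of a packing are positive and compatibility holds automatically, so
    -- only the volumes matter: finitely many open conditions.
    have e : {f | IsRegular K (spherePacking f)} = ⋂ (i) (j) (k) (l),
        {f | IsTetrahedron K i j k l → 0 < volSq (sqLen (spherePacking f)) i j k l} := by
      ext f
      simp only [Set.mem_ofPred_eq, Set.mem_iInter]
      constructor
      · intro h i j k l hT
        obtain ⟨hij, hik, hil, hjk, hjl, hkl⟩ := isTetrahedron_ne hT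
        exact (h.nondegenerate i j k l hT).volSq_pos i (by simp) j (by simp) k (by simp) l (by simp)
          hij hik hil hjk hjl hkl
      · intro h
        refine ⟨fun i j k l hT => ⟨fun a _ b _ _ => hlen f a b, fun a _ b _ c _ _ _ _ => ?_,
          fun a ha b hb c hc e he hab hac hae hbc hbe hce => h a b c e ⟨?_, ?_⟩⟩,
          fun i j k _ => by unfold spherePacking; ring, fun i j _ => hlen f i j⟩
        · rw [areaSq_pack (d := spherePacking f) (r := fun i => Real.exp (f i)) fun _ _ => rfl]
          positivity
        · exact Finset.card_eq_succ.2 ⟨a, {b, c, e}, by grind, rfl,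
            Finset.card_eq_three.2 ⟨b, c, e, hbc, hbe, hce, rfl⟩⟩
        · exact (K.isRelLowerSet_faces hT.2).2 (Finset.insert_subset ha (Finset.insert_subset hb
            (Finset.insert_subset hc (Finset.singleton_subset_iff.2 he)))) (by simp)
    rw [e]
    refine isOpen_iInter_of_finite fun i => isOpen_iInter_of_finite fun j =>
      isOpen_iInter_of_finite fun k => isOpen_iInter_of_finite fun l => ?_
    by_cases hT : IsTetrahedron K i j k l
    · simp only [hT, true_imp_iff]
      refine isOpen_lt continuous_const ?_
      have := hc i j
      have := hc i k
      have := hc i l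
      have := hc j k
      have := hc j l
      have := hc k l
      unfold volSq
      fun_prop
    · simp [hT]
  smooth i j _ := by
    unfold spherePacking
    fun_prop
  regular f hf := hf
  partialDeriv_len i j hE f _ := by
    unfold len spherePacking
    rw [partialDeriv_add (by fun_prop) (by fun_prop), partialDeriv_exp, partialDeriv_exp, if_pos rfl,
      if_neg hE.1, add_zero]
  partialDeriv_eq_zero i j _ k hki _ f _ := by
    unfold spherePacking
    rw [partialDeriv_exp, if_neg hki]

theorem IsRegularConformal.isConvexFunctionalOn {U : Set (V → ℝ)} {C : (V → ℝ) → V → V → ℝ}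
    (h : IsRegularConformal K U C) {S : Set (V → ℝ)} (hSU : S ⊆ U)
    (hK : ∀ f ∈ S, ∀ i, 0 ≤ scalarCurvature K (C f) i)
    (hE : ∀ f ∈ S, ∀ v, 0 ≤ edgeForm K (C f) (qCoeff C f) v) :
    IsConvexFunctionalOn (fun f => EHR K (C f)) S := by
  refine isConvexFunctionalOn_of_iteratedDeriv (fun f hf => h.contDiffAt_EHR (hSU hf))
    fun f hf v => ?_
  rw [h.iteratedDeriv_two_EHR (hSU hf)]
  exact add_nonneg (Finset.sum_nonneg fun i _ => mul_nonneg (hK f hf i) (sq_nonneg _)) (hE f hf v)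

end Convexity

end PiecewiseFlat

theorem mainTheorem7 {M : Type*} [TopologicalSpace M] [T2Space M] [CompactSpace M]
    [ChartedSpace (EuclideanSpace ℝ (Fin 3)) M]
    {V : Type*} [Fintype V] [DecidableEq V] (T : PiecewiseFlat.Triangulation M V) :
    PiecewiseFlat.IsConvexFunctionalOn
      (fun f => PiecewiseFlat.EHR T.complex (PiecewiseFlat.spherePacking f))
      {f | f ∈ PiecewiseFlat.spherePackingDomain T.complex ∧
        ∀ i, 0 ≤ PiecewiseFlat.scalarCurvature T.complex (PiecewiseFlat.spherePacking f) i} ∧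
    ∀ (U : Set (V → ℝ)) (C : (V → ℝ) → V → V → ℝ),
      PiecewiseFlat.IsConformalStructure T.complex U C →
      PiecewiseFlat.IsConvexFunctionalOn
        (fun f => PiecewiseFlat.EHR T.complex (C f))
        {f | f ∈ U ∧
          (∀ i j, PiecewiseFlat.IsEdge T.complex i j →
            0 < PiecewiseFlat.dualLen T.complex (C f) i j -
              (1 / 2) * PiecewiseFlat.qCoeff C f i j *
                PiecewiseFlat.edgeCurvature T.complex (C f) i j) ∧
          ∀ i, 0 ≤ PiecewiseFlat.scalarCurvature T.complex (C f) i} := by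
  -- The regular parameters form an open set containing all metrics, so no realization has to be
  -- rebuilt from inequalities to obtain an open domain.
  refine ⟨?_, fun U C hC => ?_⟩
  · refine (PiecewiseFlat.isRegularConformal_spherePacking T.complex).isConvexFunctionalOn
      (fun f hf => hf.1.isRegular) (fun f hf => hf.2) fun f hf v =>
      PiecewiseFlat.edgeForm_spherePacking_nonneg hf.1.isRegular (fun i j hE => ?_) v
    exact (PiecewiseFlat.partialDeriv_exp i j f).trans (if_neg hE.1.symm)
  · exact hC.isRegularConformal.isConvexFunctionalOn (fun f hf => hf.1) (fun f hf => hf.2.2)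
      fun f hf v => PiecewiseFlat.edgeForm_nonneg (hC.isMetric f hf.1).isRegular hf.2.1 v
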